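/- **Setting.** Let $k\ge 1$. A mechanism is a triple $(Z,\mathbf P,\mathbf Q)$: $Z$ is any measurable space of signals; $\mathbf P=(P_u)_{u\in\mathbb R}$ assigns to each user $u\in\mathbb R$ a probability distribution $P_u$ on $Z$; $\mathbf Q=(Q_s)_{s\in Z}$ assigns (measurably in $s$) to each signal a probability distribution $Q_s$ on $\mathbb R^k$. Let $\mathfrak h$ be a continuous increasing function on $[0,\infty)$ with $\mathfrak h(0)=0$ such that, for some $B>0$, $\log\mathfrak h$ is finite and Lipschitz on $[B,\infty)$. The cost of a mechanism is $$\mathrm{cost}^{\mathfrak h}(Z,\mathbf P,\mathbf Q)=\sup_{u\in\mathbb R}\ \mathbb E_{s\sim P_u}\,\mathbb E_{a\sim Q_s}\Big[\min_{1\le i\le k}\mathfrak h(|u-a_i|)\Big]\in[0,\infty].$$ Let $\mathfrak g:[0,\infty)\to[0,\infty]$ be increasing and convex with $\mathfrak g(0)=0$, (right-)differentiable at $0$ with finite derivative $\mathfrak g'(0)\ne 0$ (so $\mathfrak g'(0)>0$). $\mathbf P$ is $\mathfrak g$-geographically differentially private if $P_{u_1}(S)\le e^{\mathfrak g(|u_1-u_2|)}P_{u_2}(S)$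 for all $u_1,u_2\in\mathbb R$ and all measurable $S\subseteq Z$ (no condition on the pair $u_1,u_2$ if $\mathfrak g(|u_1-u_2|)=\infty$). Let $f^{\mathfrak h}(\mathfrak g,k)$ be the infimum of $\mathrm{cost}^{\mathfrak h}(Z,\mathbf P,\mathbf Q)$ over all mechanisms whose $\mathbf P$ is $\mathfrak g$-geographically differentially private. **Theorem.** 1. For all such $\mathfrak h,\mathfrak g,k$, adding Laplace noise is an optimal user action: let $Z=\mathbb R$ and let $P^*_u$ be the law of $u+X$, where $X$ has density $\rho(x)=\frac{\mathfrak g'(0)}2e^{-\mathfrak g'(0)|x|}$. Then $\mathbf P^*$ is $\mathfrak g$-geographically differentially private, and there is a server action $\mathbf Q$ with $\mathrm{cost}^{\mathfrak h}(\mathbb R,\mathbf P^*,\mathbf Q)=f^{\mathfrak h}(\mathfrak g,k)$. 2. For $\mathfrak h(z)=z$ we have $f^{\mathfrak h}(\mathfrak g,k)=O\big(\frac1{\mathfrak g'(0)\,k}\big)$: there is an absolute constant $C$ such that $f^{\mathfrak h}(\mathfrak g,k)\le \frac{C}{\mathfrak g'(0)\,k}$ for all $\mathfrak g$ as above and all $k\ge1$.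 3. For $\mathfrak h(z)=z$ an optimal mechanism is given in closed form: the users play $\mathbf P^*$, and the server answers a signal $s$ deterministically by $(s+x_1,\dots,s+x_k)$, where $x_{k+1-i}=-x_i$ for all $i$ and, for $1\le i\le (k+1)/2$, $$x_i=-\frac{2}{\mathfrak g'(0)}\log\frac{t+1}{i}\ \text{ if } k=2t+1,\qquad x_i=-\frac{1}{\mathfrak g'(0)}\log\frac{t(t+1)}{i^2}\ \text{ if } k=2t.$$ The cost of this mechanism equals $f^{\mathfrak h}(\mathfrak g,k)$. -/

import Mathlib

open MeasureTheory ProbabilityTheory Filter Topology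
open scoped NNReal ENNReal

universe v

/-- Admissible disutility functions `h` on `[0, ∞)`: continuous, increasing, `h 0 = 0`, and
`log h` is (well defined and) Lipschitz on some half-line `[B, ∞)` with `B > 0`. -/
structure IsDisutility (h : ℝ → ℝ) : Prop where
  continuousOn : ContinuousOn h (Set.Ici 0)
  monotoneOn : MonotoneOn h (Set.Ici 0)
  map_zero : h 0 = 0
  log_lipschitz : ∃ B : ℝ, 0 < B ∧ (∀ z, B ≤ z → 0 < h z) ∧
    ∃ K : ℝ≥0, LipschitzOnWith K (fun z => Real.log (h z)) (Set.Ici B)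

/-- `g : [0, ∞) → [0, ∞]` is an admissible privacy profile with (right) derivative `ε` at `0`:
it is increasing and convex, `g 0 = 0`, and it is differentiable at `0` with `g'(0) = ε ≠ 0`.
The value `∞` is allowed. Since `g 0 = 0`, the difference quotient at `0` is `g t / t`; it is
nonnegative, so `ε ≠ 0` means `0 < ε`. -/
structure IsPrivacyProfile (g : ℝ≥0 → ℝ≥0∞) (ε : ℝ) : Prop where
  monotone : Monotone g
  convex : ConvexOn ℝ≥0 Set.univ g
  map_zero : g 0 = 0
  deriv_zero : Tendsto (fun t : ℝ≥0 => g t / (t : ℝ≥0∞)) (𝓝[≠] 0) (𝓝 (ENNReal.ofReal ε))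
  deriv_pos : 0 < ε

/-- `P` is an action of the users with signal space `Z` (a probability distribution `P u` of
signals for each user `u`) which is `g`-geographically differentially private:
`P u₁ (S) ≤ exp (g |u₁ - u₂|) * P u₂ (S)`. There is no constraint on the pair `u₁, u₂` when
`g |u₁ - u₂| = ∞`. -/
structure IsGeoPrivate (g : ℝ≥0 → ℝ≥0∞) {Z : Type v} [MeasurableSpace Z]
    (P : ℝ → Measure Z) : Prop where
  isProbabilityMeasure : ∀ u, IsProbabilityMeasure (P u)
  le_exp_mul : ∀ u₁ u₂ : ℝ, g (nndist u₁ u₂) ≠ ∞ → ∀ S : Set Z, MeasurableSet S →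
    P u₁ S ≤ ENNReal.ofReal (Real.exp (g (nndist u₁ u₂)).toReal) * P u₂ S

/-- Disutility of user `u` from the results `a₁, …, a_k`: the minimum of `h |u - a_i|`. -/
noncomputable def minDisutility (h : ℝ → ℝ) {k : ℕ} (u : ℝ) (a : Fin k → ℝ) : ℝ≥0∞ :=
  ⨅ i, ENNReal.ofReal (h |u - a i|)

/-- Worst-case expected disutility of the mechanism `(Z, P, Q)`: user `u` draws a signal `s` from
`P u`, and the server, on receiving `s`, draws its `k` results from `Q s`. -/
noncomputable def mechanismCost (h : ℝ → ℝ) {k : ℕ} {Z : Type v} [MeasurableSpace Z]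
    (P : ℝ → Measure Z) (Q : Kernel Z (Fin k → ℝ)) : ℝ≥0∞ :=
  ⨆ u : ℝ, ∫⁻ s, ∫⁻ a, minDisutility h u a ∂(Q s) ∂(P u)

/-- The optimal cost: the infimum of the cost over all signal spaces `Z`, all private user
actions `P` and all server actions `Q`. -/
noncomputable def optimalCost (h : ℝ → ℝ) (g : ℝ≥0 → ℝ≥0∞) (k : ℕ) : ℝ≥0∞ :=
  ⨅ (Z : Type v) (_ : MeasurableSpace Z) (P : ℝ → Measure Z) (_ : IsGeoPrivate g P)
    (Q : Kernel Z (Fin k → ℝ)) (_ : IsMarkovKernel Q), mechanismCost h P Q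

/-- Laplace noise of rate `ε`, with density `(ε / 2) * exp (-ε |x|)`. -/
noncomputable def laplaceNoise (ε : ℝ) : Measure ℝ :=
  volume.withDensity fun x => ENNReal.ofReal (ε / 2 * Real.exp (-ε * |x|))

/-- The user action of adding Laplace noise: user `u` sends `u + x` with `x` Laplace noise. -/
noncomputable def laplaceAction (ε : ℝ) (u : ℝ) : Measure ℝ :=
  (laplaceNoise ε).map fun x => u + x

/-- The server action which answers the signal `s` by `s + a₁, …, s + a_k`. -/
noncomputable def shiftResponse {k : ℕ} (a : Fin k → ℝ) : Kernel ℝ (Fin k → ℝ) :=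
  Kernel.deterministic (fun s i => s + a i)
    (measurable_pi_lambda _ fun i => measurable_id.add_const (a i))

/-- Distance from `0` of the `j`-th outermost closed-form point on either side,
`1 ≤ j ≤ (k + 1) / 2`. For odd `k = 2t + 1` it is `(2 / ε) * log ((t + 1) / j)` and for even
`k = 2t` it is `(1 / ε) * log (t (t + 1) / j ^ 2)`. -/
noncomputable def closedFormRadius (k : ℕ) (ε : ℝ) (j : ℕ) : ℝ :=
  if Odd k then 2 * Real.log ((((k : ℝ) + 1) / 2) / j) / ε
  else Real.log (((k : ℝ) / 2) * ((k : ℝ) / 2 + 1) / (j : ℝ) ^ 2) / ε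

/-- The closed-form points `x₁ ≤ … ≤ x_k`, symmetric about `0`; `i : Fin k` stands for the index
`i + 1`. -/
noncomputable def closedFormPoint (k : ℕ) (ε : ℝ) (i : Fin k) : ℝ :=
  if 2 * ((i : ℕ) + 1) ≤ k + 1 then -closedFormRadius k ε ((i : ℕ) + 1)
  else closedFormRadius k ε (k - (i : ℕ))

/-!
A finite distance can be cut into pieces so short that `g t ≤ ε' t` on them, where `ε' > ε` is
arbitrary, so privacy makes `log P_u(S)` an `ε`-Lipschitz function of `u`. Draw the user from a
Laplace prior of rate `ε' - ε`. By Bayes' rule, after each signal the density `φ` of the user is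
`ε'`-log-Lipschitz.

For such `φ` the function `exp (ε' u) φ u` is increasing in `u`. On a half-line `φ` is therefore a
mixture of the exponential tails `u ↦ exp (-ε' u)` on `u > c`, and a lower bound for the mean of a
function over every such tail is one for its mean against `φ`. A given list of answers is split at
its median. Beyond a point `c` to the right of it, the answers do no better than the symmetric list
obtained by reflecting about `c` those to the right of `c`, and the mean over the tail is then the
cost of that symmetric list under Laplace noise. So the best list under Laplace noise of rate `ε'`
bounds every mechanism from below; a compactness argument gives the limit `ε' → ε` and shows that
the best list exists. Convexity puts `g` above its tangent at `0`, which makes Laplace noise of rate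
`ε` private.

For linear disutility only a symmetric list, that is a list on a half-line, is to be optimised.
The exponential law is memoryless, so the optimum for `k + 1` answers follows from the one for `k`
by choosing the distance to the first answer, or the midpoint between the first two. Both choices
come down to `1 + x ≤ exp x`, with equality at the closed-form answers.
-/

/-! ### Integrals over upper sets and half-lines -/

theorem lintegral_ofReal_le_lintegral_ofReal_of_forall_isUpperSet {α : Type*} [Preorder α]
    [MeasurableSpace α] {μ ν : Measure α}
    (h : ∀ U : Set α, IsUpperSet U → MeasurableSet U → μ U ≤ ν U) {q : α → ℝ} (hq : Monotone q)
    (hqm : Measurable q) (hq0 : ∀ x, 0 ≤ q x) :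
    ∫⁻ x, ENNReal.ofReal (q x) ∂μ ≤ ∫⁻ x, ENNReal.ofReal (q x) ∂ν := by
  rw [lintegral_eq_lintegral_meas_lt μ (.of_forall hq0) hqm.aemeasurable,
    lintegral_eq_lintegral_meas_lt ν (.of_forall hq0) hqm.aemeasurable]
  exact lintegral_mono fun t => h _ (fun x y hxy hx => lt_of_lt_of_le hx (hq hxy))
    (measurableSet_lt measurable_const hqm)

theorem lintegral_le_lintegral_of_forall_isUpperSet {α : Type*} [Preorder α] [MeasurableSpace α]
    {μ ν : Measure α} (h : ∀ U : Set α, IsUpperSet U → MeasurableSet U → μ U ≤ ν U)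
    {q : α → ℝ≥0∞} (hq : Monotone q) (hqm : Measurable q) : ∫⁻ x, q x ∂μ ≤ ∫⁻ x, q x ∂ν := by
  have hfin (n : ℕ) (x : α) : min (q x) n ≠ ∞ :=
    ne_top_of_le_ne_top (ENNReal.natCast_ne_top n) (min_le_right _ _)
  have htrunc (n : ℕ) : ∫⁻ x, min (q x) n ∂μ ≤ ∫⁻ x, min (q x) n ∂ν := by
    have := lintegral_ofReal_le_lintegral_ofReal_of_forall_isUpperSet h
      (fun x y hxy => ENNReal.toReal_mono (hfin n y) (min_le_min_right _ (hq hxy)))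
      (hqm.min measurable_const).ennreal_toReal fun x => ENNReal.toReal_nonneg
    simpa only [ENNReal.ofReal_toReal (hfin n _)] using this
  have hsup (m : Measure α) : ∫⁻ x, q x ∂m = ⨆ n : ℕ, ∫⁻ x, min (q x) n ∂m := by
    rw [← lintegral_iSup (fun n => hqm.min measurable_const)
      fun i j hij x => min_le_min_left _ (Nat.cast_le.2 hij)]
    simp_rw [← inf_iSup_eq, ENNReal.iSup_natCast, inf_top_eq]
  rw [hsup μ, hsup ν]
  exact iSup_mono htrunc

theorem ae_eq_Ioi_sInf_of_isUpperSet {α : Type*} [ConditionallyCompleteLinearOrder α]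
    [MeasurableSpace α] (μ : Measure α) [NullSingletonClass μ] {U : Set α} (hU : IsUpperSet U)
    (hne : U.Nonempty) (hbdd : BddBelow U) : U =ᵐ[μ] Set.Ioi (sInf U) := by
  refine EventuallyLE.antisymm ?_ (LE.le.eventuallyLE fun x hx => ?_)
  · exact (LE.le.eventuallyLE fun x hx => csInf_le hbdd hx).trans Ioi_ae_eq_Ici.symm.le
  · obtain ⟨y, hy, hyx⟩ := exists_lt_of_csInf_lt hne hx
    exact hU hyx.le hy

theorem mul_setLIntegral_Ioi_le_of_forall_le {μ : Measure ℝ} [NullSingletonClass μ] {c : ℝ}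
    {l : ℝ≥0∞} {F q : ℝ → ℝ≥0∞} (hF : Measurable F)
    (h : ∀ c', c ≤ c' → l * μ (Set.Ioi c') ≤ ∫⁻ x in Set.Ioi c', F x ∂μ) (hq : Monotone q) :
    l * ∫⁻ x in Set.Ioi c, q x ∂μ ≤ ∫⁻ x in Set.Ioi c, q x * F x ∂μ := by
  have hupper (U : Set ℝ) (hU : IsUpperSet U) (hUm : MeasurableSet U) :
      (l • μ.restrict (Set.Ioi c)) U ≤ (μ.restrict (Set.Ioi c)).withDensity F U := by
    rw [Measure.smul_apply, Measure.restrict_apply hUm, withDensity_apply _ hUm,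
      Measure.restrict_restrict hUm, smul_eq_mul]
    rcases (U ∩ Set.Ioi c).eq_empty_or_nonempty with hempty | hne
    · simp [hempty]
    have hge (x : ℝ) (hx : x ∈ U ∩ Set.Ioi c) : c ≤ x := (Set.mem_Ioi.1 hx.2).le
    have hae := ae_eq_Ioi_sInf_of_isUpperSet μ (hU.inter (isUpperSet_Ioi c)) hne ⟨c, hge⟩
    rw [measure_congr hae, Measure.restrict_congr_set hae]
    exact h _ (le_csInf hne hge)
  have := lintegral_le_lintegral_of_forall_isUpperSet hupper hq hq.measurable
  rw [lintegral_smul_measure, smul_eq_mul,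
    lintegral_withDensity_eq_lintegral_mul _ hF hq.measurable] at this
  simpa only [Pi.mul_apply, mul_comm (F _)] using this

theorem lintegral_comp_neg (f : ℝ → ℝ≥0∞) : ∫⁻ x, f (-x) = ∫⁻ x, f x :=
  (Measure.measurePreserving_neg (volume : Measure ℝ)).lintegral_comp_emb
    (MeasurableEquiv.neg ℝ).measurableEmbedding f

theorem setLIntegral_Ioi_comp_neg (f : ℝ → ℝ≥0∞) (c : ℝ) :
    ∫⁻ x in Set.Ioi (-c), f (-x) = ∫⁻ x in Set.Iio c, f x := by
  have := (Measure.measurePreserving_neg (volume : Measure ℝ)).setLIntegral_comp_preimage_emb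
    (MeasurableEquiv.neg ℝ).measurableEmbedding f (Set.Iio c)
  simpa using this

theorem setLIntegral_Ioi_add_left (f : ℝ → ℝ≥0∞) (c d : ℝ) :
    ∫⁻ x in Set.Ioi d, f (c + x) = ∫⁻ x in Set.Ioi (c + d), f x := by
  have := (measurePreserving_add_left (volume : Measure ℝ) c).setLIntegral_comp_preimage_emb
    (MeasurableEquiv.addLeft c).measurableEmbedding f (Set.Ioi (c + d))
  simpa using this

theorem lintegral_eq_Ioi_add_Ioi_neg (f : ℝ → ℝ≥0∞) (c : ℝ) :
    ∫⁻ x, f x = (∫⁻ x in Set.Ioi c, f x) + ∫⁻ x in Set.Ioi (-c), f (-x) := by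
  rw [setLIntegral_Ioi_comp_neg, Measure.restrict_congr_set Iio_ae_eq_Iic, add_comm,
    ← Set.compl_Iic, lintegral_add_compl _ measurableSet_Iic]

/-! ### Log-Lipschitz weights -/

theorem ofReal_exp_mul_ofReal_exp (x y : ℝ) :
    ENNReal.ofReal (Real.exp x) * ENNReal.ofReal (Real.exp y) =
      ENNReal.ofReal (Real.exp (x + y)) := by
  rw [← ENNReal.ofReal_mul (Real.exp_pos x).le, Real.exp_add]

/-- A log-Lipschitz weight of rate `ε` on the line: `log φ` is `ε`-Lipschitz. The multiplicative
form also covers weights which are constantly `0` or `∞`. -/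
def IsLogLipschitz (ε : ℝ) (φ : ℝ → ℝ≥0∞) : Prop :=
  ∀ u v, φ u ≤ ENNReal.ofReal (Real.exp (ε * |u - v|)) * φ v

namespace IsLogLipschitz

variable {ε δ : ℝ} {φ ψ : ℝ → ℝ≥0∞}

theorem monotone_exp_mul (h : IsLogLipschitz ε φ) :
    Monotone fun u => ENNReal.ofReal (Real.exp (ε * u)) * φ u := fun u v huv =>
  calc ENNReal.ofReal (Real.exp (ε * u)) * φ u
      ≤ ENNReal.ofReal (Real.exp (ε * u)) *
        (ENNReal.ofReal (Real.exp (ε * |u - v|)) * φ v) := by gcongr; exact h u v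
    _ = ENNReal.ofReal (Real.exp (ε * v)) * φ v := by
      rw [← mul_assoc, ofReal_exp_mul_ofReal_exp, abs_of_nonpos (sub_nonpos.2 huv)]
      ring_nf

theorem measurable (h : IsLogLipschitz ε φ) : Measurable φ := by
  have hmul (u : ℝ) : ENNReal.ofReal (Real.exp (-(ε * u))) *
      (ENNReal.ofReal (Real.exp (ε * u)) * φ u) = φ u := by
    rw [← mul_assoc, ofReal_exp_mul_ofReal_exp]
    simp
  have hprod : Measurable fun u : ℝ => ENNReal.ofReal (Real.exp (-(ε * u))) *
      (ENNReal.ofReal (Real.exp (ε * u)) * φ u) :=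
    Measurable.mul (by fun_prop) h.monotone_exp_mul.measurable
  simpa only [hmul] using hprod

theorem comp_neg (h : IsLogLipschitz ε φ) : IsLogLipschitz ε fun u => φ (-u) := fun u v => by
  simpa only [neg_sub_neg, abs_sub_comm v u] using h (-u) (-v)

theorem const_mul (c : ℝ≥0∞) (h : IsLogLipschitz ε φ) : IsLogLipschitz ε fun u => c * φ u :=
  fun u v => (mul_le_mul_right (h u v) c).trans_eq (mul_left_comm _ _ _)

theorem mul_const (h : IsLogLipschitz ε φ) (c : ℝ≥0∞) : IsLogLipschitz ε fun u => φ u * c := by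
  simpa only [mul_comm] using h.const_mul c

theorem mul (h : IsLogLipschitz ε φ) (h' : IsLogLipschitz δ ψ) :
    IsLogLipschitz (ε + δ) fun u => φ u * ψ u := fun u v => by
  rw [add_mul, ← ofReal_exp_mul_ofReal_exp, mul_mul_mul_comm]
  exact mul_le_mul' (h u v) (h' u v)

theorem iSup {ι : Sort*} {φ : ι → ℝ → ℝ≥0∞} (h : ∀ i, IsLogLipschitz ε (φ i)) :
    IsLogLipschitz ε fun u => ⨆ i, φ i u := fun u v =>
  iSup_le fun i => (h i u v).trans <| by gcongr; exact le_iSup (φ · v) i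

theorem lintegral {α : Type*} [MeasurableSpace α] {μ : Measure α} {φ : ℝ → α → ℝ≥0∞}
    (h : ∀ x, IsLogLipschitz ε fun u => φ u x) : IsLogLipschitz ε fun u => ∫⁻ x, φ u x ∂μ :=
  fun u v => by
    rw [← lintegral_const_mul' _ _ ENNReal.ofReal_ne_top]
    exact lintegral_mono fun x => h x u v

theorem of_forall_abs_sub_lt {r : ℝ} (hr : 0 < r)
    (h : ∀ u v, |u - v| < r → φ u ≤ ENNReal.ofReal (Real.exp (ε * |u - v|)) * φ v) :
    IsLogLipschitz ε φ := by
  have hdouble (n : ℕ) : ∀ u v, |u - v| < 2 ^ n * r →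
      φ u ≤ ENNReal.ofReal (Real.exp (ε * |u - v|)) * φ v := by
    induction n with
    | zero => simpa only [pow_zero, one_mul] using h
    | succ n ih =>
      intro u v huv
      have hum : |u - (u + v) / 2| = |u - v| / 2 := by
        rw [← abs_of_pos (two_pos (α := ℝ)), ← abs_div, abs_of_pos (two_pos (α := ℝ))]; ring_nf
      have hmv : |(u + v) / 2 - v| = |u - v| / 2 := by
        rw [← abs_of_pos (two_pos (α := ℝ)), ← abs_div, abs_of_pos (two_pos (α := ℝ))]; ring_nf
      have hhalf : |u - v| / 2 < 2 ^ n * r := by rw [pow_succ] at huv; linarith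
      calc φ u ≤ _ * φ ((u + v) / 2) := ih _ _ (hum.trans_lt hhalf)
        _ ≤ _ * (_ * φ v) := by gcongr; exact ih _ _ (hmv.trans_lt hhalf)
        _ = _ := by
          rw [hum, hmv, ← mul_assoc, ofReal_exp_mul_ofReal_exp, ← mul_add, add_halves]
  intro u v
  obtain ⟨n, hn⟩ := pow_unbounded_of_one_lt (|u - v| / r) one_lt_two
  exact hdouble n u v ((div_lt_iff₀ hr).1 hn)

theorem of_forall_gt (h : ∀ ε', ε < ε' → IsLogLipschitz ε' φ) : IsLogLipschitz ε φ := fun u v => by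
  have hlim : Tendsto (fun ε' => ENNReal.ofReal (Real.exp (ε' * |u - v|)) * φ v) (𝓝[>] ε)
      (𝓝 (ENNReal.ofReal (Real.exp (ε * |u - v|)) * φ v)) := by
    have hcont : Continuous fun ε' => ENNReal.ofReal (Real.exp (ε' * |u - v|)) :=
      ENNReal.continuous_ofReal.comp (by fun_prop)
    exact ENNReal.Tendsto.mul_const (hcont.continuousWithinAt (s := Set.Ioi ε))
      (Or.inl (ENNReal.ofReal_pos.2 (Real.exp_pos _)).ne')
  exact ge_of_tendsto hlim (eventually_mem_nhdsWithin.mono fun ε' hε' => h ε' hε' u v)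

end IsLogLipschitz

theorem isLogLipschitz_exp_neg_abs_sub {ε : ℝ} (hε : 0 ≤ ε) (r : ℝ) :
    IsLogLipschitz ε fun u => ENNReal.ofReal (Real.exp (-ε * |u - r|)) := fun u v => by
  rw [ofReal_exp_mul_ofReal_exp]
  refine ENNReal.ofReal_le_ofReal (Real.exp_le_exp.2 ?_)
  linear_combination ε * abs_sub_le v u r + ε * (abs_sub_comm v u).le

/-! ### Exponential tails -/

/-- The mean of `F (c + X)` for an exponentially distributed `X` of rate `ε`. -/
noncomputable def expTail (ε c : ℝ) (F : ℝ → ℝ≥0∞) : ℝ≥0∞ :=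
  ∫⁻ x in Set.Ioi 0, ENNReal.ofReal (ε * Real.exp (-ε * x)) * F (c + x)

theorem expTail_mono {ε c : ℝ} {F G : ℝ → ℝ≥0∞} (h : ∀ x, c < x → F x ≤ G x) :
    expTail ε c F ≤ expTail ε c G :=
  setLIntegral_mono' measurableSet_Ioi fun x hx => by
    gcongr; exact h _ (lt_add_of_pos_right c hx)

theorem expTail_add (ε c d : ℝ) (F : ℝ → ℝ≥0∞) :
    expTail ε (c + d) F = expTail ε d fun x => F (c + x) := by
  simp only [expTail, add_assoc]

theorem setLIntegral_Ioi_exp {ε : ℝ} (hε : 0 < ε) (c : ℝ) :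
    ∫⁻ x in Set.Ioi c, ENNReal.ofReal (Real.exp (-ε * x)) =
      ENNReal.ofReal (Real.exp (-ε * c) / ε) := by
  rw [← ofReal_integral_eq_lintegral_ofReal (integrableOn_exp_mul_Ioi (neg_lt_zero.2 hε) c)
    (.of_forall fun x => (Real.exp_pos _).le), integral_exp_mul_Ioi (neg_lt_zero.2 hε) c,
    neg_div_neg_eq]

theorem expTail_one {ε : ℝ} (hε : 0 < ε) (c : ℝ) : expTail ε c (fun _ => 1) = 1 := by
  simp only [expTail, mul_one, ENNReal.ofReal_mul hε.le]
  rw [lintegral_const_mul' _ _ ENNReal.ofReal_ne_top, setLIntegral_Ioi_exp hε,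
    ← ENNReal.ofReal_mul hε.le, mul_zero, Real.exp_zero, mul_one_div_cancel hε.ne',
    ENNReal.ofReal_one]

theorem setLIntegral_Ioi_exp_mul {ε : ℝ} (hε : 0 < ε) (c : ℝ) (F : ℝ → ℝ≥0∞) :
    ∫⁻ x in Set.Ioi c, ENNReal.ofReal (Real.exp (-ε * x)) * F x =
      ENNReal.ofReal (Real.exp (-ε * c) / ε) * expTail ε c F := by
  have hfactor (x : ℝ) : ENNReal.ofReal (Real.exp (-ε * (c + x))) * F (c + x) =
      ENNReal.ofReal (Real.exp (-ε * c) / ε) *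
        (ENNReal.ofReal (ε * Real.exp (-ε * x)) * F (c + x)) := by
    rw [← mul_assoc, ← ENNReal.ofReal_mul (by positivity), mul_add, Real.exp_add]
    field_simp
  have := setLIntegral_Ioi_add_left (fun x => ENNReal.ofReal (Real.exp (-ε * x)) * F x) c 0
  rw [add_zero] at this
  simp only [← this, hfactor, expTail, lintegral_const_mul' _ _ ENNReal.ofReal_ne_top]

/-- The law of `X` is memoryless: given `X > d` it is the law of `d + X`. -/
theorem expTail_eq_setLIntegral_Ioc_add {ε d : ℝ} (hε : 0 < ε) (hd : 0 ≤ d) (c : ℝ)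
    (F : ℝ → ℝ≥0∞) :
    expTail ε c F = (∫⁻ x in Set.Ioc 0 d, ENNReal.ofReal (ε * Real.exp (-ε * x)) * F (c + x)) +
      ENNReal.ofReal (Real.exp (-ε * d)) * expTail ε (c + d) F := by
  have hfactor (x : ℝ) : ENNReal.ofReal (ε * Real.exp (-ε * x)) * F (c + x) =
      ENNReal.ofReal ε * (ENNReal.ofReal (Real.exp (-ε * x)) * F (c + x)) := by
    rw [ENNReal.ofReal_mul hε.le, mul_assoc]
  rw [expTail, ← Set.Ioc_union_Ioi_eq_Ioi hd,
    lintegral_union measurableSet_Ioi (Set.Ioc_disjoint_Ioi le_rfl), expTail_add]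
  congr 1
  simp only [hfactor, lintegral_const_mul' _ _ ENNReal.ofReal_ne_top]
  rw [setLIntegral_Ioi_exp_mul hε d fun x => F (c + x), ← mul_assoc, ← ENNReal.ofReal_mul hε.le,
    mul_div_cancel₀ _ hε.ne']

theorem mul_setLIntegral_Ioi_le_of_le_expTail {ε c : ℝ} (hε : 0 < ε) {F : ℝ → ℝ≥0∞}
    (hF : Measurable F) {l : ℝ≥0∞} (hl : ∀ c', c ≤ c' → l ≤ expTail ε c' F) {φ : ℝ → ℝ≥0∞}
    (hφ : Monotone fun u => ENNReal.ofReal (Real.exp (ε * u)) * φ u) :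
    l * ∫⁻ u in Set.Ioi c, φ u ≤ ∫⁻ u in Set.Ioi c, φ u * F u := by
  let μ : Measure ℝ := volume.withDensity fun x => ENNReal.ofReal (Real.exp (-ε * x))
  have hμ (c' : ℝ) (G : ℝ → ℝ≥0∞) : ∫⁻ x in Set.Ioi c', G x ∂μ =
      ∫⁻ x in Set.Ioi c', ENNReal.ofReal (Real.exp (-ε * x)) * G x :=
    setLIntegral_withDensity_eq_setLIntegral_mul_non_measurable _ (by fun_prop) _
      measurableSet_Ioi (.of_forall fun x => ENNReal.ofReal_lt_top)
  have htail (c' : ℝ) (hc' : c ≤ c') : l * μ (Set.Ioi c') ≤ ∫⁻ x in Set.Ioi c', F x ∂μ := by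
    rw [hμ, setLIntegral_Ioi_exp_mul hε, withDensity_apply _ measurableSet_Ioi,
      setLIntegral_Ioi_exp hε, mul_comm]
    gcongr
    exact hl c' hc'
  have hcancel (u : ℝ) : ENNReal.ofReal (Real.exp (-ε * u)) *
      (ENNReal.ofReal (Real.exp (ε * u)) * φ u) = φ u := by
    rw [← mul_assoc, ofReal_exp_mul_ofReal_exp]
    simp
  have := mul_setLIntegral_Ioi_le_of_forall_le hF htail hφ
  simpa only [hμ, ← mul_assoc _ _ (F _), hcancel] using this

theorem mul_lintegral_le_of_le_expTail {ε : ℝ} (hε : 0 < ε) (c : ℝ) {F : ℝ → ℝ≥0∞}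
    (hF : Measurable F) {l : ℝ≥0∞} (hright : ∀ c', c ≤ c' → l ≤ expTail ε c' F)
    (hleft : ∀ c', -c ≤ c' → l ≤ expTail ε c' fun x => F (-x)) {φ : ℝ → ℝ≥0∞}
    (hφ : IsLogLipschitz ε φ) : l * ∫⁻ u, φ u ≤ ∫⁻ u, φ u * F u := by
  rw [lintegral_eq_Ioi_add_Ioi_neg φ c, lintegral_eq_Ioi_add_Ioi_neg (fun u => φ u * F u) c,
    mul_add]
  exact add_le_add (mul_setLIntegral_Ioi_le_of_le_expTail hε hF hright hφ.monotone_exp_mul)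
    (mul_setLIntegral_Ioi_le_of_le_expTail hε (hF.comp measurable_neg) hleft
      hφ.comp_neg.monotone_exp_mul)

/-! ### Laplace noise -/

/-- The density of `laplaceNoise ε`. -/
noncomputable def laplaceDensity (ε x : ℝ) : ℝ≥0∞ :=
  ENNReal.ofReal (ε / 2 * Real.exp (-ε * |x|))

theorem measurable_laplaceDensity (ε : ℝ) : Measurable (laplaceDensity ε) := by
  unfold laplaceDensity
  fun_prop

theorem laplaceDensity_neg (ε x : ℝ) : laplaceDensity ε (-x) = laplaceDensity ε x := by
  rw [laplaceDensity, laplaceDensity, abs_neg]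

theorem isLogLipschitz_laplaceDensity {ε : ℝ} (hε : 0 ≤ ε) :
    IsLogLipschitz ε (laplaceDensity ε) := by
  have := (isLogLipschitz_exp_neg_abs_sub hε 0).const_mul (ENNReal.ofReal (ε / 2))
  simp only [sub_zero, ← ENNReal.ofReal_mul (div_nonneg hε zero_le_two)] at this
  exact this

theorem lintegral_laplaceNoise (ε : ℝ) (F : ℝ → ℝ≥0∞) :
    ∫⁻ x, F x ∂(laplaceNoise ε) = ∫⁻ x, laplaceDensity ε x * F x :=
  lintegral_withDensity_eq_lintegral_mul_non_measurable _ (measurable_laplaceDensity ε)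
    (.of_forall fun _ => ENNReal.ofReal_lt_top) F

theorem lintegral_laplaceNoise_comp_neg (ε : ℝ) (F : ℝ → ℝ≥0∞) :
    ∫⁻ x, F (-x) ∂(laplaceNoise ε) = ∫⁻ x, F x ∂(laplaceNoise ε) := by
  rw [lintegral_laplaceNoise, lintegral_laplaceNoise,
    ← lintegral_comp_neg fun x => laplaceDensity ε x * F x]
  simp only [laplaceDensity_neg]

theorem setLIntegral_Ioi_zero_laplaceDensity_mul (ε : ℝ) (F : ℝ → ℝ≥0∞) :
    ∫⁻ x in Set.Ioi 0, laplaceDensity ε x * F x = 2⁻¹ * expTail ε 0 F := by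
  rw [expTail, ← lintegral_const_mul' _ _ (ENNReal.inv_ne_top.2 two_ne_zero)]
  refine setLIntegral_congr_fun measurableSet_Ioi fun x hx => ?_
  simp only [laplaceDensity, zero_add]
  rw [abs_of_pos hx, ← mul_assoc, ← ENNReal.ofReal_ofNat, ← ENNReal.ofReal_inv_of_pos two_pos,
    ← ENNReal.ofReal_mul (by positivity)]
  ring_nf

theorem lintegral_laplaceNoise_eq_expTail (ε : ℝ) (F : ℝ → ℝ≥0∞) :
    ∫⁻ x, F x ∂(laplaceNoise ε) =
      2⁻¹ * (expTail ε 0 F + expTail ε 0 fun x => F (-x)) := by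
  rw [lintegral_laplaceNoise, lintegral_eq_Ioi_add_Ioi_neg _ 0, neg_zero, mul_add]
  simp only [laplaceDensity_neg, setLIntegral_Ioi_zero_laplaceDensity_mul]

theorem isProbabilityMeasure_laplaceNoise {ε : ℝ} (hε : 0 < ε) :
    IsProbabilityMeasure (laplaceNoise ε) := by
  constructor
  rw [← lintegral_one, lintegral_laplaceNoise_eq_expTail, expTail_one hε, one_add_one_eq_two,
    ENNReal.inv_mul_cancel two_ne_zero ENNReal.ofNat_ne_top]

theorem lintegral_laplaceDensity {ε : ℝ} (hε : 0 < ε) : ∫⁻ x, laplaceDensity ε x = 1 := by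
  have := isProbabilityMeasure_laplaceNoise hε
  simpa using (lintegral_laplaceNoise ε fun _ => 1).symm

theorem laplaceAction_eq_withDensity (ε u : ℝ) :
    laplaceAction ε u = volume.withDensity fun x => laplaceDensity ε (x - u) := by
  ext S hS
  have := (measurePreserving_add_left (volume : Measure ℝ) u).setLIntegral_comp_preimage_emb
    (MeasurableEquiv.addLeft u).measurableEmbedding (fun x => laplaceDensity ε (x - u)) S
  simp only [add_sub_cancel_left] at this
  rw [laplaceAction, Measure.map_apply (measurable_const_add u) hS, laplaceNoise,
    withDensity_apply _ (measurable_const_add u hS), withDensity_apply _ hS, ← this]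
  rfl

theorem isLogLipschitz_laplaceAction_apply {ε : ℝ} (hε : 0 ≤ ε) {S : Set ℝ}
    (hS : MeasurableSet S) : IsLogLipschitz ε fun u => laplaceAction ε u S := by
  simp only [laplaceAction_eq_withDensity, withDensity_apply _ hS]
  refine IsLogLipschitz.lintegral fun x u v => ?_
  simpa only [sub_sub_sub_cancel_left, abs_sub_comm v u] using
    isLogLipschitz_laplaceDensity hε (x - u) (x - v)

/-! ### The disutility of a list of answers -/

theorem measurable_comp_abs_of_monotoneOn {h : ℝ → ℝ} (hm : MonotoneOn h (Set.Ici 0)) :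
    Measurable fun x => h |x| := by
  have hmono : Monotone fun x => h (max x 0) := fun x y hxy =>
    hm (le_max_right x 0) (le_max_right y 0) (max_le_max_right 0 hxy)
  have habs (x : ℝ) : max |x| 0 = |x| := max_eq_left (abs_nonneg x)
  simpa only [Function.comp_def, habs] using hmono.measurable.comp measurable_abs

section MinDisutility

variable {h : ℝ → ℝ} {k : ℕ}

theorem measurable_minDisutility (hm : MonotoneOn h (Set.Ici 0)) (k : ℕ) :
    Measurable fun p : ℝ × (Fin k → ℝ) => minDisutility h p.1 p.2 :=
  Measurable.iInf fun i => ENNReal.measurable_ofReal.comp <|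
    (measurable_comp_abs_of_monotoneOn hm).comp <|
      measurable_fst.sub ((measurable_pi_apply i).comp measurable_snd)

theorem measurable_minDisutility_left (hm : MonotoneOn h (Set.Ici 0)) (a : Fin k → ℝ) :
    Measurable fun u => minDisutility h u a :=
  (measurable_minDisutility hm k).comp measurable_prodMk_right

theorem measurable_minDisutility_right (hm : MonotoneOn h (Set.Ici 0)) (u : ℝ) :
    Measurable fun a : Fin k → ℝ => minDisutility h u a :=
  (measurable_minDisutility hm k).comp measurable_prodMk_left

theorem minDisutility_le_of_forall_exists (hm : MonotoneOn h (Set.Ici 0)) {m : ℕ} {u v : ℝ}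
    {a : Fin k → ℝ} {b : Fin m → ℝ} (hab : ∀ i, ∃ j, |u - b j| ≤ |v - a i|) :
    minDisutility h u b ≤ minDisutility h v a :=
  le_iInf fun i => by
    obtain ⟨j, hj⟩ := hab i
    exact iInf_le_of_le j <| ENNReal.ofReal_le_ofReal <|
      hm (abs_nonneg (u - b j)) (abs_nonneg (v - a i)) hj

theorem minDisutility_comp_perm (h : ℝ → ℝ) (u : ℝ) (a : Fin k → ℝ) (σ : Equiv.Perm (Fin k)) :
    minDisutility h u (a ∘ σ) = minDisutility h u a :=
  Equiv.iInf_comp (g := fun i => ENNReal.ofReal (h |u - a i|)) σ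

theorem minDisutility_neg_left (h : ℝ → ℝ) (u : ℝ) (a : Fin k → ℝ) :
    minDisutility h (-u) a = minDisutility h u (-a) := by
  simp only [minDisutility, Pi.neg_apply, sub_neg_eq_add, ← neg_add', abs_neg]

theorem minDisutility_neg_rev (h : ℝ → ℝ) (u : ℝ) (a : Fin k → ℝ) :
    (minDisutility h u fun i => -a i.rev) = minDisutility h (-u) a := by
  rw [minDisutility_neg_left, ← minDisutility_comp_perm h u (-a) Fin.revPerm]
  rfl

theorem minDisutility_neg_of_rev_eq_neg {b : Fin k → ℝ} (hb : ∀ i, b i.rev = -b i)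
    (h : ℝ → ℝ) (x : ℝ) : minDisutility h (-x) b = minDisutility h x b := by
  rw [← minDisutility_neg_rev]
  simp only [hb, neg_neg]

theorem minDisutility_add_left (h : ℝ → ℝ) (u x : ℝ) (a : Fin k → ℝ) :
    (minDisutility h u fun i => u + x + a i) = minDisutility h (-x) a := by
  simp only [minDisutility, add_assoc, sub_add_cancel_left, neg_add']

/-- Expected disutility of the answers `a` for a user with Laplace distributed position. -/
noncomputable def laplaceCost (h : ℝ → ℝ) {k : ℕ} (ε : ℝ) (a : Fin k → ℝ) : ℝ≥0∞ :=
  ∫⁻ x, minDisutility h x a ∂(laplaceNoise ε)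

theorem mechanismCost_laplaceAction_shiftResponse (hm : MonotoneOn h (Set.Ici 0)) (ε : ℝ)
    (a : Fin k → ℝ) : mechanismCost h (laplaceAction ε) (shiftResponse a) = laplaceCost h ε a := by
  have huser (u : ℝ) : ∫⁻ s, ∫⁻ b, minDisutility h u b ∂(shiftResponse a s) ∂(laplaceAction ε u) =
      laplaceCost h ε a := by
    have hmeas : Measurable fun s : ℝ => minDisutility h u fun i => s + a i :=
      (measurable_minDisutility_right hm u).comp
        (measurable_pi_lambda _ fun i => measurable_id.add_const (a i))
    simp only [shiftResponse,
      Kernel.lintegral_deterministic' _ (measurable_minDisutility_right hm u)]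
    rw [laplaceAction, lintegral_map hmeas (measurable_const_add u)]
    simp only [minDisutility_add_left]
    exact lintegral_laplaceNoise_comp_neg ε fun x => minDisutility h x a
  simp only [mechanismCost, huser, ciSup_const]

theorem laplaceCost_eq_expTail_of_rev_eq_neg {b : Fin k → ℝ} (hb : ∀ i, b i.rev = -b i)
    (h : ℝ → ℝ) (ε : ℝ) : laplaceCost h ε b = expTail ε 0 fun x => minDisutility h x b := by
  simp only [laplaceCost, lintegral_laplaceNoise_eq_expTail, minDisutility_neg_of_rev_eq_neg hb]
  rw [← two_mul, ← mul_assoc, ENNReal.inv_mul_cancel two_ne_zero ENNReal.ofNat_ne_top, one_mul]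

end MinDisutility

/-! ### Symmetric lists -/

/-- Lists of answers which are symmetric about `0`, the second half being nonnegative. For odd `k`
the index `k / 2` is the middle one, so that entry is `0`. -/
structure IsSymmetricList {k : ℕ} (b : Fin k → ℝ) : Prop where
  rev : ∀ i, b i.rev = -b i
  nonneg : ∀ i : Fin k, k / 2 ≤ (i : ℕ) → 0 ≤ b i

section Median

variable {k : ℕ} [NeZero k]

/-- The upper one of the two (possibly equal) middle indices; the lower one is
`upperMiddle.rev`. -/
def upperMiddle : Fin k :=
  ⟨k / 2, Nat.div_lt_self (NeZero.pos k) one_lt_two⟩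

theorem rev_le_upperMiddle_rev_iff {i : Fin k} :
    i.rev ≤ upperMiddle.rev ↔ k / 2 ≤ (i : ℕ) := by
  rw [Fin.rev_le_rev, Fin.le_def, upperMiddle]

theorem le_upperMiddle_rev_of_lt_upperMiddle {i : Fin k} (hi : i < upperMiddle) :
    i ≤ upperMiddle.rev := by
  simp only [Fin.lt_def, Fin.le_def, Fin.val_rev, upperMiddle] at hi ⊢
  omega

theorem upperMiddle_rev_le_upperMiddle : (upperMiddle : Fin k).rev ≤ upperMiddle := by
  simp only [Fin.le_def, Fin.val_rev, upperMiddle]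
  omega

/-- The median of a sorted list, the mean of its two middle entries. -/
noncomputable def median (a : Fin k → ℝ) : ℝ :=
  (a upperMiddle.rev + a upperMiddle) / 2

theorem median_neg_rev (a : Fin k → ℝ) : (median fun i => -a i.rev) = -median a := by
  simp only [median, Fin.rev_rev]
  ring

/-- The symmetric list of the entries to the right of `c`, relative to `c`, and their mirror
images, filled up with zeros. -/
noncomputable def reflectAbout (c : ℝ) (a : Fin k → ℝ) (i : Fin k) : ℝ :=
  max (a i - c) 0 - max (a i.rev - c) 0

variable {a : Fin k → ℝ} {c : ℝ}

theorem reflectAbout_of_half_le (ha : Monotone a) (hc : median a ≤ c) {i : Fin k}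
    (hi : k / 2 ≤ (i : ℕ)) : reflectAbout c a i = max (a i - c) 0 := by
  have hmid : a upperMiddle.rev ≤ c := by
    have := ha (upperMiddle_rev_le_upperMiddle (k := k))
    rw [median] at hc
    linarith
  have hrev : a i.rev ≤ c := (ha (rev_le_upperMiddle_rev_iff.2 hi)).trans hmid
  rw [reflectAbout, max_eq_right (sub_nonpos.2 hrev), sub_zero]

theorem isSymmetricList_reflectAbout (ha : Monotone a) (hc : median a ≤ c) :
    IsSymmetricList (reflectAbout c a) where
  rev i := by simp only [reflectAbout, Fin.rev_rev, neg_sub]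
  nonneg i hi := reflectAbout_of_half_le ha hc hi ▸ le_max_right _ _

theorem exists_abs_sub_reflectAbout_le (ha : Monotone a) (hc : median a ≤ c) {x : ℝ} (hx : 0 ≤ x)
    (i : Fin k) : ∃ j, |x - reflectAbout c a j| ≤ |c + x - a i| := by
  have hupper := reflectAbout_of_half_le ha hc (i := upperMiddle) le_rfl
  rcases le_or_gt (a i) c with hic | hic
  · refine ⟨upperMiddle, ?_⟩
    have hdist : max (a upperMiddle - c) 0 ≤ c - a i := by
      refine max_le ?_ (sub_nonneg.2 hic)
      rcases le_or_gt upperMiddle i with hi | hi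
      · linarith [ha hi]
      · have := ha (le_upperMiddle_rev_of_lt_upperMiddle hi)
        rw [median] at hc
        linarith
    rw [hupper, abs_of_nonneg (show 0 ≤ c + x - a i by linarith), abs_le]
    constructor <;> linarith [le_max_right (a upperMiddle - c) 0]
  · have hi : k / 2 ≤ (i : ℕ) := by
      by_contra hlt
      have := ha (le_upperMiddle_rev_of_lt_upperMiddle (Fin.lt_def.2 (not_le.1 hlt)))
      have := ha (upperMiddle_rev_le_upperMiddle (k := k))
      rw [median] at hc
      linarith
    refine ⟨i, le_of_eq ?_⟩
    rw [reflectAbout_of_half_le ha hc hi, max_eq_left (sub_nonneg.2 hic.le)]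
    ring_nf

end Median

section PosteriorWeight

variable {h : ℝ → ℝ} {k : ℕ} [NeZero k] {ε : ℝ} {l : ℝ≥0∞}

theorem le_expTail_of_median_le (hm : MonotoneOn h (Set.Ici 0))
    (hl : ∀ b : Fin k → ℝ, IsSymmetricList b → l ≤ laplaceCost h ε b) {a : Fin k → ℝ}
    (ha : Monotone a) {c : ℝ} (hc : median a ≤ c) :
    l ≤ expTail ε c fun u => minDisutility h u a := by
  have hb := isSymmetricList_reflectAbout ha hc
  calc l ≤ laplaceCost h ε (reflectAbout c a) := hl _ hb
    _ = expTail ε 0 fun x => minDisutility h x (reflectAbout c a) :=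
        laplaceCost_eq_expTail_of_rev_eq_neg hb.rev h ε
    _ ≤ expTail ε 0 fun x => minDisutility h (c + x) a := expTail_mono fun x hx =>
        minDisutility_le_of_forall_exists hm (exists_abs_sub_reflectAbout_le ha hc hx.le)
    _ = expTail ε c fun u => minDisutility h u a := by
        rw [← expTail_add ε c 0 fun u => minDisutility h u a, add_zero]

theorem mul_lintegral_le_of_le_laplaceCost (hm : MonotoneOn h (Set.Ici 0)) (hε : 0 < ε)
    (hl : ∀ b : Fin k → ℝ, IsSymmetricList b → l ≤ laplaceCost h ε b) {φ : ℝ → ℝ≥0∞}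
    (hφ : IsLogLipschitz ε φ) (a : Fin k → ℝ) :
    l * ∫⁻ u, φ u ≤ ∫⁻ u, φ u * minDisutility h u a := by
  wlog ha : Monotone a generalizing a
  · simpa only [minDisutility_comp_perm] using this _ (Tuple.monotone_sort a)
  refine mul_lintegral_le_of_le_expTail hε (median a) (measurable_minDisutility_left hm a)
    (fun c hc => le_expTail_of_median_le hm hl ha hc) (fun c hc => ?_) hφ
  rw [← median_neg_rev] at hc
  simp only [← minDisutility_neg_rev]
  exact le_expTail_of_median_le hm hl (fun i j hij => neg_le_neg (ha (Fin.rev_le_rev.2 hij))) hc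

theorem le_laplaceCost_of_forall_isSymmetricList (hm : MonotoneOn h (Set.Ici 0)) (hε : 0 < ε)
    (hl : ∀ b : Fin k → ℝ, IsSymmetricList b → l ≤ laplaceCost h ε b) (a : Fin k → ℝ) :
    l ≤ laplaceCost h ε a := by
  have := mul_lintegral_le_of_le_laplaceCost hm hε hl (isLogLipschitz_laplaceDensity hε.le) a
  rwa [lintegral_laplaceDensity hε, mul_one, ← lintegral_laplaceNoise] at this

end PosteriorWeight

/-! ### Private user actions -/

/-- The privacy profile `g` has right derivative `ε > 0` at `0` and lies above its tangent there:
the derivative limits what any private action reveals, the tangent makes Laplace noise private. -/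
structure HasSupportingTangent (g : ℝ≥0 → ℝ≥0∞) (ε : ℝ) : Prop where
  deriv_zero : Tendsto (fun t : ℝ≥0 => g t / (t : ℝ≥0∞)) (𝓝[≠] 0) (𝓝 (ENNReal.ofReal ε))
  le : ∀ t : ℝ≥0, ENNReal.ofReal ε * t ≤ g t
  pos : 0 < ε

theorem IsPrivacyProfile.apply_mul_le {g : ℝ≥0 → ℝ≥0∞} {ε : ℝ} (hg : IsPrivacyProfile g ε)
    {s : ℝ≥0} (hs : s ≤ 1) (t : ℝ≥0) : g (s * t) ≤ s * g t := by
  have hconv := hg.convex.2 (Set.mem_univ t) (Set.mem_univ 0) (zero_le : 0 ≤ s)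
    (zero_le : 0 ≤ 1 - s) (add_tsub_cancel_of_le hs)
  simpa only [hg.map_zero, smul_zero, mul_zero, add_zero, smul_eq_mul, ENNReal.smul_def] using hconv

theorem IsPrivacyProfile.hasSupportingTangent {g : ℝ≥0 → ℝ≥0∞} {ε : ℝ}
    (hg : IsPrivacyProfile g ε) : HasSupportingTangent g ε := by
  refine ⟨hg.deriv_zero, fun t => ?_, hg.deriv_pos⟩
  rcases eq_or_ne t 0 with rfl | ht
  · simp
  have ht' : (t : ℝ≥0∞) ≠ 0 := ENNReal.coe_ne_zero.2 ht
  have hscale : Tendsto (fun s : ℝ≥0 => s * t) (𝓝[≠] 0) (𝓝[≠] 0) := by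
    refine tendsto_nhdsWithin_iff.2 ⟨?_, eventually_mem_nhdsWithin.mono fun s hs =>
      mul_ne_zero hs ht⟩
    have hzero : Tendsto (fun s : ℝ≥0 => s * t) (𝓝 0) (𝓝 0) :=
      Continuous.tendsto' (by fun_prop) _ _ (zero_mul t)
    exact hzero.mono_left nhdsWithin_le_nhds
  have hsmall : ∀ᶠ s : ℝ≥0 in 𝓝[≠] 0, s < 1 := nhdsWithin_le_nhds (gt_mem_nhds zero_lt_one)
  rw [← ENNReal.le_div_iff_mul_le (Or.inl ht') (Or.inl ENNReal.coe_ne_top)]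
  refine le_of_tendsto (hg.deriv_zero.comp hscale) ?_
  filter_upwards [self_mem_nhdsWithin, hsmall] with s hs hs1
  calc g (s * t) / ((s * t : ℝ≥0) : ℝ≥0∞) ≤ (s * g t) / (s * t) := by
        rw [ENNReal.coe_mul]
        exact ENNReal.div_le_div_right (hg.apply_mul_le hs1.le t) _
    _ = g t / t := ENNReal.mul_div_mul_left _ _ (ENNReal.coe_ne_zero.2 hs) ENNReal.coe_ne_top

theorem coe_nndist_eq_ofReal_abs_sub (u v : ℝ) :
    (nndist u v : ℝ≥0∞) = ENNReal.ofReal |u - v| := by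
  rw [← edist_nndist, edist_dist, Real.dist_eq]

theorem isGeoPrivate_laplaceAction {g : ℝ≥0 → ℝ≥0∞} {ε : ℝ} (hg : HasSupportingTangent g ε) :
    IsGeoPrivate g (laplaceAction ε) where
  isProbabilityMeasure u := by
    have := isProbabilityMeasure_laplaceNoise hg.pos
    exact Measure.isProbabilityMeasure_map (by fun_prop)
  le_exp_mul u v hfin S hS := by
    refine (isLogLipschitz_laplaceAction_apply hg.pos.le hS u v).trans ?_
    gcongr
    refine (ENNReal.ofReal_le_iff_le_toReal hfin).1 ?_
    rw [ENNReal.ofReal_mul hg.pos.le, ← coe_nndist_eq_ofReal_abs_sub]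
    exact hg.le _

section GeoPrivate

variable {g : ℝ≥0 → ℝ≥0∞} {ε : ℝ} {Z : Type*} [MeasurableSpace Z] {P : ℝ → Measure Z}

theorem IsGeoPrivate.apply_le_of_le (hP : IsGeoPrivate g P) {x u v : ℝ}
    (hx : 0 ≤ x) (hg : g (nndist u v) ≤ ENNReal.ofReal x) {S : Set Z} (hS : MeasurableSet S) :
    P u S ≤ ENNReal.ofReal (Real.exp x) * P v S := by
  refine (hP.le_exp_mul u v (ne_top_of_le_ne_top ENNReal.ofReal_ne_top hg) S hS).trans ?_
  gcongr
  exact ENNReal.toReal_le_of_le_ofReal hx hg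

theorem IsGeoPrivate.isLogLipschitz_apply (hP : IsGeoPrivate g P) (hε : 0 ≤ ε)
    (hg : Tendsto (fun t : ℝ≥0 => g t / (t : ℝ≥0∞)) (𝓝[≠] 0) (𝓝 (ENNReal.ofReal ε))) {S : Set Z}
    (hS : MeasurableSet S) : IsLogLipschitz ε fun u => P u S := by
  refine IsLogLipschitz.of_forall_gt fun ε' hε' => ?_
  have hε'0 : 0 < ε' := hε.trans_lt hε'
  have hev := hg.eventually (gt_mem_nhds ((ENNReal.ofReal_lt_ofReal_iff hε'0).2 hε'))
  rw [eventually_nhdsWithin_iff, Metric.eventually_nhds_iff] at hev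
  obtain ⟨r, hr, hlt⟩ := hev
  refine IsLogLipschitz.of_forall_abs_sub_lt hr fun u v huv => ?_
  rcases eq_or_ne u v with rfl | hne
  · simp
  have hd : nndist u v ≠ 0 := nndist_eq_zero.not.2 hne
  have hquot := hlt (y := nndist u v) (by simpa [NNReal.dist_eq, Real.dist_eq] using huv) hd
  refine hP.apply_le_of_le (mul_nonneg hε'0.le (abs_nonneg _)) ?_ hS
  rw [ENNReal.ofReal_mul hε'0.le, ← coe_nndist_eq_ofReal_abs_sub]
  exact (ENNReal.div_le_iff (ENNReal.coe_ne_zero.2 hd) ENNReal.coe_ne_top).1 hquot.le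

/-- A version, log-Lipschitz in `u` for every signal, of the density of `P u` with respect to
`P 0`: the largest lower bound which the densities at rational points impose at `u`. -/
noncomputable def envelopeDensity (ε : ℝ) (P : ℝ → Measure Z) (u : ℝ) (s : Z) : ℝ≥0∞ :=
  ⨆ r : ℚ, ENNReal.ofReal (Real.exp (-ε * |u - r|)) * (P r).rnDeriv (P 0) s

theorem measurable_uncurry_envelopeDensity (ε : ℝ) (P : ℝ → Measure Z) :
    Measurable (Function.uncurry (envelopeDensity ε P)) := by
  refine Measurable.iSup fun r => Measurable.mul (by fun_prop) ?_
  exact (Measure.measurable_rnDeriv _ _).comp measurable_snd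

theorem isLogLipschitz_envelopeDensity (hε : 0 ≤ ε) (P : ℝ → Measure Z) (s : Z) :
    IsLogLipschitz ε fun u => envelopeDensity ε P u s :=
  IsLogLipschitz.iSup fun r => (isLogLipschitz_exp_neg_abs_sub hε r).mul_const _

theorem absolutelyContinuous_of_isLogLipschitz
    (hP : ∀ S, MeasurableSet S → IsLogLipschitz ε fun u => P u S) (u v : ℝ) : P u ≪ P v :=
  Measure.AbsolutelyContinuous.mk fun S hS h0 =>
    le_zero_iff.1 <| (hP S hS u v).trans_eq <| by simp only [h0, mul_zero]

theorem envelopeDensity_ae_le_rnDeriv [∀ u, IsFiniteMeasure (P u)]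
    (hP : ∀ S, MeasurableSet S → IsLogLipschitz ε fun u => P u S) (u : ℝ) :
    envelopeDensity ε P u ≤ᵐ[P 0] (P u).rnDeriv (P 0) := by
  have hac := absolutelyContinuous_of_isLogLipschitz hP
  have hterm (r : ℚ) : (fun s => ENNReal.ofReal (Real.exp (-ε * |u - r|)) *
      (P r).rnDeriv (P 0) s) ≤ᵐ[P 0] (P u).rnDeriv (P 0) := by
    refine ae_le_of_forall_setLIntegral_le_of_sigmaFinite
      ((Measure.measurable_rnDeriv _ _).const_mul _) fun S hS _ => ?_
    rw [lintegral_const_mul' _ _ ENNReal.ofReal_ne_top, Measure.setLIntegral_rnDeriv (hac _ _),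
      Measure.setLIntegral_rnDeriv (hac _ _)]
    calc ENNReal.ofReal (Real.exp (-ε * |u - r|)) * P r S
        ≤ ENNReal.ofReal (Real.exp (-ε * |u - r|)) *
          (ENNReal.ofReal (Real.exp (ε * |(r : ℝ) - u|)) * P u S) := by
          gcongr; exact hP S hS r u
      _ = P u S := by
          rw [← mul_assoc, ofReal_exp_mul_ofReal_exp, abs_sub_comm]
          simp
  filter_upwards [ae_all_iff.2 hterm] with s hs
  exact iSup_le hs

theorem withDensity_envelopeDensity_le [∀ u, IsFiniteMeasure (P u)]
    (hP : ∀ S, MeasurableSet S → IsLogLipschitz ε fun u => P u S) (u : ℝ) :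
    (P 0).withDensity (envelopeDensity ε P u) ≤ P u :=
  (withDensity_mono (envelopeDensity_ae_le_rnDeriv hP u)).trans_eq
    (Measure.withDensity_rnDeriv_eq _ _ (absolutelyContinuous_of_isLogLipschitz hP u 0))

theorem one_le_lintegral_envelopeDensity [∀ u, IsProbabilityMeasure (P u)]
    (hP : ∀ S, MeasurableSet S → IsLogLipschitz ε fun u => P u S) (u : ℝ) :
    1 ≤ ∫⁻ s, envelopeDensity ε P u s ∂P 0 := by
  have hrat (r : ℚ) : ENNReal.ofReal (Real.exp (-ε * |u - r|)) ≤
      ∫⁻ s, envelopeDensity ε P u s ∂P 0 := by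
    calc ENNReal.ofReal (Real.exp (-ε * |u - r|))
        = ∫⁻ s, ENNReal.ofReal (Real.exp (-ε * |u - r|)) * (P r).rnDeriv (P 0) s ∂P 0 := by
          rw [lintegral_const_mul' _ _ ENNReal.ofReal_ne_top,
            Measure.lintegral_rnDeriv (absolutelyContinuous_of_isLogLipschitz hP r 0),
            measure_univ, mul_one]
      _ ≤ _ := lintegral_mono fun s => le_iSup (fun r : ℚ =>
          ENNReal.ofReal (Real.exp (-ε * |u - r|)) * (P r).rnDeriv (P 0) s) r
  have hclosed : IsClosed {x : ℝ | ENNReal.ofReal (Real.exp (-ε * |u - x|)) ≤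
      ∫⁻ s, envelopeDensity ε P u s ∂P 0} :=
    isClosed_le (ENNReal.continuous_ofReal.comp (by fun_prop)) continuous_const
  simpa using Rat.denseRange_cast.induction_on (p := fun x : ℝ =>
    ENNReal.ofReal (Real.exp (-ε * |u - x|)) ≤ ∫⁻ s, envelopeDensity ε P u s ∂P 0) u hclosed hrat

end GeoPrivate

/-! ### Bayesian lower bound -/

/-- The worst case over `u` is at least the average over a prior `π`, which is computed from the
posterior weights `p · s`. -/
theorem le_iSup_lintegral_of_forall_posterior {Θ Z : Type*} [MeasurableSpace Θ]
    [MeasurableSpace Z] (π : Measure Θ) [IsProbabilityMeasure π] {ν : Measure Z} [SFinite ν]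
    {P : Θ → Measure Z} {p G : Θ → Z → ℝ≥0∞} (hp : Measurable (Function.uncurry p))
    (hG : Measurable (Function.uncurry G)) (hmass : ∀ u, 1 ≤ ∫⁻ s, p u s ∂ν)
    (hle : ∀ u, ν.withDensity (p u) ≤ P u) {l : ℝ≥0∞}
    (hpost : ∀ s, l * ∫⁻ u, p u s ∂π ≤ ∫⁻ u, p u s * G u s ∂π) :
    l ≤ ⨆ u, ∫⁻ s, G u s ∂P u := by
  have hp' : Measurable fun x : Z × Θ => p x.2 x.1 := hp.comp measurable_swap
  have hpG : Measurable fun x : Θ × Z => p x.1 x.2 * G x.1 x.2 := hp.mul hG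
  have huser (u : Θ) : ∫⁻ s, p u s * G u s ∂ν ≤ ⨆ u, ∫⁻ s, G u s ∂P u :=
    calc ∫⁻ s, p u s * G u s ∂ν = ∫⁻ s, G u s ∂(ν.withDensity (p u)) :=
          (lintegral_withDensity_eq_lintegral_mul _ hp.of_uncurry_left hG.of_uncurry_left).symm
      _ ≤ ∫⁻ s, G u s ∂P u := lintegral_mono' (hle u) le_rfl
      _ ≤ _ := le_iSup (fun u => ∫⁻ s, G u s ∂P u) u
  calc l = l * ∫⁻ _, 1 ∂π := by rw [lintegral_one, measure_univ, mul_one]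
    _ ≤ l * ∫⁻ u, ∫⁻ s, p u s ∂ν ∂π := by gcongr with u; exact hmass u
    _ = ∫⁻ s, l * ∫⁻ u, p u s ∂π ∂ν := by
        rw [lintegral_const_mul _ hp'.lintegral_prod_right',
          lintegral_lintegral_swap hp.aemeasurable]
    _ ≤ ∫⁻ s, ∫⁻ u, p u s * G u s ∂π ∂ν := lintegral_mono hpost
    _ = ∫⁻ u, ∫⁻ s, p u s * G u s ∂ν ∂π := (lintegral_lintegral_swap hpG.aemeasurable).symm
    _ ≤ ∫⁻ _, ⨆ u, ∫⁻ s, G u s ∂P u ∂π := lintegral_mono huser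
    _ = ⨆ u, ∫⁻ s, G u s ∂P u := by rw [lintegral_const, measure_univ, mul_one]

section LowerBound

variable {h : ℝ → ℝ} {k : ℕ} {ε ε' : ℝ} {l : ℝ≥0∞} {Z : Type*} [MeasurableSpace Z]

theorem measurable_lintegral_minDisutility (hm : MonotoneOn h (Set.Ici 0))
    (Q : Kernel Z (Fin k → ℝ)) [IsSFiniteKernel Q] :
    Measurable (Function.uncurry fun u s => ∫⁻ a, minDisutility h u a ∂(Q s)) := by
  have hproj : Measurable fun y : (ℝ × Z) × (Fin k → ℝ) => (y.1.1, y.2) := by fun_prop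
  have hcomp := (measurable_minDisutility hm k).comp hproj
  exact Measurable.lintegral_kernel_prod_right
    (κ := Q.comap (Prod.snd : ℝ × Z → Z) measurable_snd)
    (f := fun (x : ℝ × Z) a => minDisutility h x.1 a) hcomp

theorem mul_lintegral_le_lintegral_mul_lintegral_minDisutility [NeZero k]
    (hm : MonotoneOn h (Set.Ici 0)) (hε : 0 < ε)
    (hl : ∀ b : Fin k → ℝ, IsSymmetricList b → l ≤ laplaceCost h ε b) {φ : ℝ → ℝ≥0∞}
    (hφ : IsLogLipschitz ε φ) (ν : Measure (Fin k → ℝ)) [IsProbabilityMeasure ν] :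
    l * ∫⁻ u, φ u ≤ ∫⁻ u, φ u * ∫⁻ a, minDisutility h u a ∂ν :=
  calc l * ∫⁻ u, φ u = ∫⁻ _, l * (∫⁻ u, φ u) ∂ν := by
        rw [lintegral_const, measure_univ, mul_one]
    _ ≤ ∫⁻ a, (∫⁻ u, φ u * minDisutility h u a) ∂ν :=
        lintegral_mono fun a => mul_lintegral_le_of_le_laplaceCost hm hε hl hφ a
    _ = ∫⁻ u, ∫⁻ a, φ u * minDisutility h u a ∂ν :=
        lintegral_lintegral_swap <| Measurable.aemeasurable <|
          (hφ.measurable.comp measurable_snd).mul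
            ((measurable_minDisutility hm k).comp measurable_swap)
    _ = ∫⁻ u, φ u * ∫⁻ a, minDisutility h u a ∂ν :=
        lintegral_congr fun u => lintegral_const_mul _ (measurable_minDisutility_right hm u)

theorem le_mechanismCost [NeZero k] (hm : MonotoneOn h (Set.Ici 0)) (hε : 0 ≤ ε)
    (hεε' : ε < ε') (hl : ∀ b : Fin k → ℝ, IsSymmetricList b → l ≤ laplaceCost h ε' b)
    {P : ℝ → Measure Z} [∀ u, IsProbabilityMeasure (P u)]
    (hP : ∀ S, MeasurableSet S → IsLogLipschitz ε fun u => P u S)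
    (Q : Kernel Z (Fin k → ℝ)) [IsMarkovKernel Q] : l ≤ mechanismCost h P Q := by
  have hδ : 0 < ε' - ε := sub_pos.2 hεε'
  have := isProbabilityMeasure_laplaceNoise hδ
  refine le_iSup_lintegral_of_forall_posterior (laplaceNoise (ε' - ε))
    (measurable_uncurry_envelopeDensity ε P) (measurable_lintegral_minDisutility hm Q)
    (one_le_lintegral_envelopeDensity hP) (withDensity_envelopeDensity_le hP) fun s => ?_
  have hposterior : IsLogLipschitz ε' fun u =>
      laplaceDensity (ε' - ε) u * envelopeDensity ε P u s := by
    simpa only [sub_add_cancel] using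
      (isLogLipschitz_laplaceDensity hδ.le).mul (isLogLipschitz_envelopeDensity hε P s)
  simpa only [lintegral_laplaceNoise, mul_assoc] using
    mul_lintegral_le_lintegral_mul_lintegral_minDisutility hm (hε.trans_lt hεε') hl hposterior
      (Q s)

end LowerBound

/-! ### Existence of optimal answers -/

section Compactness

variable {h : ℝ → ℝ} {k : ℕ}

theorem lowerSemicontinuous_ofReal_comp_abs (hc : LowerSemicontinuousOn h (Set.Ici 0)) :
    LowerSemicontinuous fun x => ENNReal.ofReal (h |x|) :=
  ENNReal.continuous_ofReal.comp_lowerSemicontinuous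
    (lowerSemicontinuousOn_univ_iff.1 <|
      hc.comp continuous_abs.continuousOn fun x _ => abs_nonneg x)
    ENNReal.ofReal_mono

/-- Answers which escape to infinity may be replaced by `0`, the value of `EReal.toReal` at `±∞`:
every user eventually prefers `0` to them. -/
theorem ofReal_comp_abs_sub_toReal_le_liminf (hc : LowerSemicontinuousOn h (Set.Ici 0))
    (hm : MonotoneOn h (Set.Ici 0)) {a : ℕ → ℝ} {α : EReal}
    (ha : Tendsto (fun n => (a n : EReal)) atTop (𝓝 α)) (x : ℝ) :
    ENNReal.ofReal (h |x - α.toReal|) ≤ liminf (fun n => ENNReal.ofReal (h |x - a n|)) atTop := by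
  have escape (hlim : Tendsto (fun n => |x - a n|) atTop atTop) :
      ENNReal.ofReal (h |x - 0|) ≤ liminf (fun n => ENNReal.ofReal (h |x - a n|)) atTop :=
    le_liminf_of_le (by isBoundedDefault) <| (hlim.eventually_ge_atTop |x - 0|).mono fun n hn =>
      ENNReal.ofReal_le_ofReal (hm (abs_nonneg (x - 0)) (abs_nonneg (x - a n)) hn)
  induction α with
  | bot =>
    have hbot := EReal.tendsto_coe_nhds_bot_iff.1 ha
    exact escape <| tendsto_abs_atTop_atTop.comp <|
      tendsto_atTop_add_const_left _ x (tendsto_neg_atBot_atTop.comp hbot)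
  | top =>
    have htop := EReal.tendsto_coe_nhds_top_iff.1 ha
    exact escape <| tendsto_abs_atBot_atTop.comp <|
      tendsto_atBot_add_const_left _ x (tendsto_neg_atTop_atBot.comp htop)
  | coe r =>
    have hr : Tendsto (fun n => x - a n) atTop (𝓝 (x - r)) := (EReal.tendsto_coe.1 ha).const_sub x
    exact ((lowerSemicontinuous_ofReal_comp_abs hc).le_liminf (x - r)).trans
      (liminf_le_liminf_of_le hr)

theorem minDisutility_toReal_le_liminf (hc : LowerSemicontinuousOn h (Set.Ici 0))
    (hm : MonotoneOn h (Set.Ici 0)) {a : ℕ → Fin k → ℝ} {α : Fin k → EReal}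
    (ha : Tendsto (fun n i => (a n i : EReal)) atTop (𝓝 α)) (x : ℝ) :
    (minDisutility h x fun i => (α i).toReal) ≤
      liminf (fun n => minDisutility h x (a n)) atTop := by
  refine le_of_forall_lt_imp_le_of_dense fun y hy => le_liminf_of_le (by isBoundedDefault) ?_
  have hentry (i : Fin k) : ∀ᶠ n in atTop, y < ENNReal.ofReal (h |x - a n i|) :=
    eventually_lt_of_lt_liminf <| (hy.trans_le (iInf_le _ i)).trans_le <|
      ofReal_comp_abs_sub_toReal_le_liminf hc hm (tendsto_pi_nhds.1 ha i) x
  filter_upwards [eventually_all.2 hentry] with n hn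
  exact le_iInf fun i => (hn i).le

theorem tendsto_laplaceDensity {e : ℕ → ℝ} {ε : ℝ} (he : Tendsto e atTop (𝓝 ε)) (x : ℝ) :
    Tendsto (fun n => laplaceDensity (e n) x) atTop (𝓝 (laplaceDensity ε x)) := by
  have hcont : Continuous fun t : ℝ => t / 2 * Real.exp (-t * |x|) := by fun_prop
  exact ENNReal.tendsto_ofReal ((hcont.tendsto ε).comp he)

theorem exists_laplaceCost_le_of_tendsto (hc : LowerSemicontinuousOn h (Set.Ici 0))
    (hm : MonotoneOn h (Set.Ici 0)) {e : ℕ → ℝ} {ε : ℝ} (he : Tendsto e atTop (𝓝 ε))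
    {L : ℕ → ℝ≥0∞} {l : ℝ≥0∞} (hL : Tendsto L atTop (𝓝 l)) {a : ℕ → Fin k → ℝ}
    (ha : ∀ n, laplaceCost h (e n) (a n) ≤ L n) : ∃ b : Fin k → ℝ, laplaceCost h ε b ≤ l := by
  obtain ⟨α, σ, hσ, hα⟩ := CompactSpace.tendsto_subseq fun n i => (a n i : EReal)
  have hpointwise (x : ℝ) : laplaceDensity ε x * minDisutility h x (fun i => (α i).toReal) ≤
      liminf (fun n => laplaceDensity (e (σ n)) x * minDisutility h x (a (σ n))) atTop := by
    rw [← (tendsto_laplaceDensity (he.comp hσ.tendsto_atTop) x).liminf_eq]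
    exact (mul_le_mul_right (minDisutility_toReal_le_liminf hc hm hα x) _).trans
      ENNReal.le_liminf_mul
  refine ⟨fun i => (α i).toReal, ?_⟩
  calc laplaceCost h ε (fun i => (α i).toReal)
      ≤ ∫⁻ x, liminf (fun n => laplaceDensity (e (σ n)) x * minDisutility h x (a (σ n))) atTop :=
        (lintegral_laplaceNoise _ _).trans_le (lintegral_mono hpointwise)
    _ ≤ liminf (fun n => ∫⁻ x, laplaceDensity (e (σ n)) x * minDisutility h x (a (σ n))) atTop :=
        lintegral_liminf_le fun n =>
          (measurable_laplaceDensity _).mul (measurable_minDisutility_left hm _)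
    _ ≤ liminf (fun n => L (σ n)) atTop := liminf_le_liminf <| .of_forall fun n =>
        (lintegral_laplaceNoise _ _).symm.trans_le (ha (σ n))
    _ = l := (hL.comp hσ.tendsto_atTop).liminf_eq

theorem exists_laplaceCost_le_of_forall_gt (hc : LowerSemicontinuousOn h (Set.Ici 0))
    (hm : MonotoneOn h (Set.Ici 0)) {ε : ℝ} {l : ℝ≥0∞}
    (hl : ∀ ε', ε < ε' → ⨅ a : Fin k → ℝ, laplaceCost h ε' a ≤ l) :
    ∃ b : Fin k → ℝ, laplaceCost h ε b ≤ l := by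
  rcases eq_top_or_lt_top l with rfl | hfin
  · exact ⟨0, le_top⟩
  obtain ⟨e, -, he, helim⟩ := exists_seq_strictAnti_tendsto ε
  obtain ⟨L, -, hL, hLlim⟩ := exists_seq_strictAnti_tendsto' hfin
  have hnear (n : ℕ) : ∃ a : Fin k → ℝ, laplaceCost h (e n) a < L n :=
    iInf_lt_iff.1 ((hl (e n) (he n)).trans_lt (hL n).1)
  choose a ha using hnear
  exact exists_laplaceCost_le_of_tendsto hc hm helim hLlim fun n => (ha n).le

end Compactness

/-! ### The optimal cost -/

section OptimalCost

variable {h : ℝ → ℝ} {g : ℝ≥0 → ℝ≥0∞} {ε : ℝ} {k : ℕ}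

theorem isMarkovKernel_shiftResponse (a : Fin k → ℝ) : IsMarkovKernel (shiftResponse a) :=
  Kernel.isMarkovKernel_deterministic _

theorem IsGeoPrivate.map {Z Z' : Type*} [MeasurableSpace Z] [MeasurableSpace Z']
    {P : ℝ → Measure Z} (hP : IsGeoPrivate g P) {f : Z → Z'} (hf : Measurable f) :
    IsGeoPrivate g fun u => (P u).map f where
  isProbabilityMeasure u :=
    have := hP.isProbabilityMeasure u
    Measure.isProbabilityMeasure_map hf.aemeasurable
  le_exp_mul u v hfin S hS := by
    rw [Measure.map_apply hf hS, Measure.map_apply hf hS]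
    exact hP.le_exp_mul u v hfin _ (hf hS)

theorem optimalCost_le_mechanismCost (hm : MonotoneOn h (Set.Ici 0)) {P : ℝ → Measure ℝ}
    (hP : IsGeoPrivate g P) (Q : Kernel ℝ (Fin k → ℝ)) [IsMarkovKernel Q] :
    optimalCost.{v} h g k ≤ mechanismCost h P Q := by
  -- A copy of the signal space `ℝ` in the universe over which `optimalCost` ranges.
  let P' (u : ℝ) : Measure (ULift.{v} ℝ) := (P u).map ULift.up
  let Q' : Kernel (ULift.{v} ℝ) (Fin k → ℝ) := Q.comap ULift.down measurable_down
  have hP' : IsGeoPrivate g P' := hP.map measurable_up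
  have hQ' : IsMarkovKernel Q' := inferInstance
  have hcost : mechanismCost h P' Q' = mechanismCost h P Q :=
    iSup_congr fun u => lintegral_map
      (measurable_lintegral_minDisutility hm Q').of_uncurry_left measurable_up
  rw [← hcost]
  exact iInf_le_of_le (ULift.{v} ℝ) <| iInf_le_of_le inferInstance <| iInf_le_of_le P' <|
    iInf_le_of_le hP' <| iInf_le_of_le Q' <| iInf_le _ hQ'

theorem optimalCost_le_laplaceCost (hm : MonotoneOn h (Set.Ici 0)) (hg : HasSupportingTangent g ε)
    (a : Fin k → ℝ) : optimalCost.{v} h g k ≤ laplaceCost h ε a := by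
  have := isMarkovKernel_shiftResponse a
  rw [← mechanismCost_laplaceAction_shiftResponse hm]
  exact optimalCost_le_mechanismCost hm (isGeoPrivate_laplaceAction hg) _

theorem exists_laplaceCost_eq_optimalCost [NeZero k] (hc : LowerSemicontinuousOn h (Set.Ici 0))
    (hm : MonotoneOn h (Set.Ici 0)) (hg : HasSupportingTangent g ε) :
    ∃ a : Fin k → ℝ, laplaceCost h ε a = optimalCost.{v} h g k := by
  have hlower (ε' : ℝ) (hε' : ε < ε') :
      ⨅ a : Fin k → ℝ, laplaceCost h ε' a ≤ optimalCost.{v} h g k :=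
    le_iInf fun Z => le_iInf fun _ => le_iInf fun P => le_iInf fun hP => le_iInf fun Q =>
      le_iInf fun _ =>
        have := hP.isProbabilityMeasure
        le_mechanismCost hm hg.pos.le hε' (fun b _ => iInf_le _ b)
          (fun S hS => hP.isLogLipschitz_apply hg.pos.le hg.deriv_zero hS) Q
  obtain ⟨a, ha⟩ := exists_laplaceCost_le_of_forall_gt hc hm hlower
  exact ⟨a, ha.antisymm (optimalCost_le_laplaceCost hm hg a)⟩

end OptimalCost

/-! ### Linear disutility: one step of the recursion -/

theorem setLIntegral_Ioc_ofReal_add_eq_of_hasDerivAt {f f' : ℝ → ℝ} {a b V : ℝ} (hab : a ≤ b)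
    (hf : ∀ x, HasDerivAt f (f' x) x) (hc : Continuous f')
    (hpos : ∀ x ∈ Set.Ioc a b, 0 ≤ f' x) (hV : 0 ≤ V) :
    (∫⁻ x in Set.Ioc a b, ENNReal.ofReal (f' x)) + ENNReal.ofReal V =
      ENNReal.ofReal (f b - f a + V) := by
  have hint := intervalIntegral.integral_eq_sub_of_hasDerivAt (fun x _ => hf x)
    (hc.intervalIntegrable a b)
  rw [intervalIntegral.integral_of_le hab] at hint
  rw [← hint, ENNReal.ofReal_add (setIntegral_nonneg measurableSet_Ioc hpos) hV,
    ofReal_integral_eq_lintegral_ofReal hc.integrableOn_Ioc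
      (ae_restrict_of_forall_mem measurableSet_Ioc hpos)]

/-- Mean distance from an exponentially distributed point of rate `ε` to a list of answers whose
first element is `d`, when the mean distance of the points beyond `d` is `V`. -/
noncomputable def leadCost (ε d V : ℝ) : ℝ :=
  d - (1 - Real.exp (-ε * d)) / ε + Real.exp (-ε * d) * V

/-- Mean distance from an exponentially distributed point of rate `ε` to a list of answers for
which `0` is the nearest one up to `s`, when the mean distance of the points beyond `s` is `V`. -/
noncomputable def trailCost (ε s V : ℝ) : ℝ :=
  1 / ε - (s + 1 / ε) * Real.exp (-ε * s) + Real.exp (-ε * s) * V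

section Step

variable {ε : ℝ} (hε : 0 < ε)

include hε

theorem ofReal_leadCost {d V : ℝ} (hd : 0 ≤ d) (hV : 0 ≤ V) :
    ENNReal.ofReal (leadCost ε d V) =
      (∫⁻ x in Set.Ioc 0 d, ENNReal.ofReal (ε * Real.exp (-ε * x)) * ENNReal.ofReal (d - x)) +
        ENNReal.ofReal (Real.exp (-ε * d)) * ENNReal.ofReal V := by
  have hderiv (x : ℝ) : HasDerivAt (fun x => (x - d + 1 / ε) * Real.exp (-ε * x))
      (ε * Real.exp (-ε * x) * (d - x)) x := by
    have hlin : HasDerivAt (fun x => x - d + 1 / ε) 1 x :=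
      ((hasDerivAt_id x).sub_const d).add_const (1 / ε)
    refine (hlin.mul ((hasDerivAt_id x).const_mul (-ε)).exp).congr_deriv ?_
    simp only [id]
    field_simp
    ring
  have hnonneg (x : ℝ) (hx : x ∈ Set.Ioc 0 d) : 0 ≤ ε * Real.exp (-ε * x) * (d - x) :=
    mul_nonneg (by positivity) (sub_nonneg.2 hx.2)
  have hpos (x : ℝ) : 0 ≤ ε * Real.exp (-ε * x) := by positivity
  simp only [← ENNReal.ofReal_mul (hpos _), ← ENNReal.ofReal_mul (Real.exp_pos (-ε * d)).le]
  rw [setLIntegral_Ioc_ofReal_add_eq_of_hasDerivAt hd hderiv (by fun_prop) hnonneg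
    (by positivity), leadCost, mul_zero, Real.exp_zero]
  ring_nf

theorem ofReal_trailCost {s V : ℝ} (hs : 0 ≤ s) (hV : 0 ≤ V) :
    ENNReal.ofReal (trailCost ε s V) =
      (∫⁻ x in Set.Ioc 0 s, ENNReal.ofReal (ε * Real.exp (-ε * x)) * ENNReal.ofReal x) +
        ENNReal.ofReal (Real.exp (-ε * s)) * ENNReal.ofReal V := by
  have hderiv (x : ℝ) : HasDerivAt (fun x => -(x + 1 / ε) * Real.exp (-ε * x))
      (ε * Real.exp (-ε * x) * x) x := by
    have hlin : HasDerivAt (fun x => -(x + 1 / ε)) (-1) x :=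
      ((hasDerivAt_id x).add_const (1 / ε)).neg
    refine (hlin.mul ((hasDerivAt_id x).const_mul (-ε)).exp).congr_deriv ?_
    simp only [id]
    field_simp
    ring
  have hnonneg (x : ℝ) (hx : x ∈ Set.Ioc 0 s) : 0 ≤ ε * Real.exp (-ε * x) * x :=
    mul_nonneg (by positivity) hx.1.le
  have hpos (x : ℝ) : 0 ≤ ε * Real.exp (-ε * x) := by positivity
  simp only [← ENNReal.ofReal_mul (hpos _), ← ENNReal.ofReal_mul (Real.exp_pos (-ε * s)).le]
  rw [setLIntegral_Ioc_ofReal_add_eq_of_hasDerivAt hs hderiv (by fun_prop) hnonneg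
    (by positivity), trailCost, mul_zero, Real.exp_zero]
  ring_nf

theorem ofReal_leadCost_le_expTail {c d V : ℝ} (hd : 0 ≤ d) (hV : 0 ≤ V) {F : ℝ → ℝ≥0∞}
    (hF : ∀ x ∈ Set.Ioc 0 d, ENNReal.ofReal (d - x) ≤ F (c + x))
    (htail : ENNReal.ofReal V ≤ expTail ε (c + d) F) :
    ENNReal.ofReal (leadCost ε d V) ≤ expTail ε c F := by
  rw [ofReal_leadCost hε hd hV, expTail_eq_setLIntegral_Ioc_add hε hd]
  gcongr ?_ + _ * ?_
  exact setLIntegral_mono' measurableSet_Ioc fun x hx => by gcongr; exact hF x hx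

theorem expTail_le_ofReal_leadCost {c d V : ℝ} (hd : 0 ≤ d) (hV : 0 ≤ V) {F : ℝ → ℝ≥0∞}
    (hF : ∀ x ∈ Set.Ioc 0 d, F (c + x) ≤ ENNReal.ofReal (d - x))
    (htail : expTail ε (c + d) F ≤ ENNReal.ofReal V) :
    expTail ε c F ≤ ENNReal.ofReal (leadCost ε d V) := by
  rw [ofReal_leadCost hε hd hV, expTail_eq_setLIntegral_Ioc_add hε hd]
  gcongr ?_ + _ * ?_
  exact setLIntegral_mono' measurableSet_Ioc fun x hx => by gcongr; exact hF x hx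

theorem ofReal_trailCost_le_expTail {c s V : ℝ} (hs : 0 ≤ s) (hV : 0 ≤ V) {F : ℝ → ℝ≥0∞}
    (hF : ∀ x ∈ Set.Ioc 0 s, ENNReal.ofReal x ≤ F (c + x))
    (htail : ENNReal.ofReal V ≤ expTail ε (c + s) F) :
    ENNReal.ofReal (trailCost ε s V) ≤ expTail ε c F := by
  rw [ofReal_trailCost hε hs hV, expTail_eq_setLIntegral_Ioc_add hε hs]
  gcongr ?_ + _ * ?_
  exact setLIntegral_mono' measurableSet_Ioc fun x hx => by gcongr; exact hF x hx

theorem expTail_le_ofReal_trailCost {c s V : ℝ} (hs : 0 ≤ s) (hV : 0 ≤ V) {F : ℝ → ℝ≥0∞}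
    (hF : ∀ x ∈ Set.Ioc 0 s, F (c + x) ≤ ENNReal.ofReal x)
    (htail : expTail ε (c + s) F ≤ ENNReal.ofReal V) :
    expTail ε c F ≤ ENNReal.ofReal (trailCost ε s V) := by
  rw [ofReal_trailCost hε hs hV, expTail_eq_setLIntegral_Ioc_add hε hs]
  gcongr ?_ + _ * ?_
  exact setLIntegral_mono' measurableSet_Ioc fun x hx => by gcongr; exact hF x hx

theorem leadCost_eq_of_exp_eq {y V : ℝ} (hy : Real.exp (ε * y) = 1 + ε * V) (d : ℝ) :
    leadCost ε d V = d + (Real.exp (ε * (y - d)) - 1) / ε := by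
  have hexp : Real.exp (ε * (y - d)) = (1 + ε * V) * Real.exp (-ε * d) := by
    rw [← hy, ← Real.exp_add]
    ring_nf
  rw [leadCost, hexp]
  field_simp
  ring

theorem le_leadCost_of_exp_eq {y V : ℝ} (hy : Real.exp (ε * y) = 1 + ε * V) (d : ℝ) :
    y ≤ leadCost ε d V := by
  rw [leadCost_eq_of_exp_eq hε hy, ← sub_le_iff_le_add', le_div_iff₀ hε]
  linarith [Real.add_one_le_exp (ε * (y - d))]

theorem leadCost_self_of_exp_eq {y V : ℝ} (hy : Real.exp (ε * y) = 1 + ε * V) :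
    leadCost ε y V = y := by
  simp [leadCost_eq_of_exp_eq hε hy]

theorem trailCost_eq (s V : ℝ) :
    trailCost ε s V = (1 - Real.exp (-ε * s) * (ε * (s - V) + 1)) / ε := by
  rw [trailCost]
  field_simp
  ring

theorem le_trailCost (s V : ℝ) : (1 - Real.exp (-ε * V)) / ε ≤ trailCost ε s V := by
  rw [trailCost_eq hε]
  gcongr
  calc Real.exp (-ε * s) * (ε * (s - V) + 1)
      ≤ Real.exp (-ε * s) * Real.exp (ε * (s - V)) := by gcongr; exact Real.add_one_le_exp _
    _ = Real.exp (-ε * V) := by rw [← Real.exp_add]; ring_nf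

theorem trailCost_self (s : ℝ) : trailCost ε s s = (1 - Real.exp (-ε * s)) / ε := by
  simp [trailCost_eq hε]

theorem expTail_ofReal_sub (c : ℝ) :
    expTail ε c (fun x => ENNReal.ofReal (x - c)) = ENNReal.ofReal (1 / ε) := by
  have hint : ∫ x in Set.Ioi 0, ε * Real.exp (-ε * x) * x = 1 / ε := by
    have hgamma := Real.integral_rpow_mul_exp_neg_mul_Ioi two_pos hε
    norm_num at hgamma
    simp only [mul_assoc, integral_const_mul, mul_comm (Real.exp _), neg_mul, hgamma]
    field_simp
  have hpos (x : ℝ) : 0 ≤ ε * Real.exp (-ε * x) := by positivity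
  simp only [expTail, add_sub_cancel_left, ← ENNReal.ofReal_mul (hpos _)]
  rw [← hint, ofReal_integral_eq_lintegral_ofReal
    (.of_integral_ne_zero (by rw [hint]; positivity))]
  exact ae_restrict_of_forall_mem measurableSet_Ioi fun x hx => mul_nonneg (hpos x) hx.le

end Step

/-! ### Linear disutility: the optimum -/

/-- The optimal cost of `k` answers for linear disutility; for even `k` it is also the distance
from `0` to the nearest closed-form answer. -/
noncomputable def linearOptimum (ε : ℝ) (k : ℕ) : ℝ :=
  if Odd k then 2 / (ε * (k + 1)) else Real.log ((k + 2) / k) / ε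

theorem linearOptimum_odd (ε : ℝ) (m : ℕ) :
    linearOptimum ε (2 * m + 1) = 1 / ((m + 1) * ε) := by
  have hcast : ε * (((2 * m + 1 : ℕ) : ℝ) + 1) = 2 * ((m + 1) * ε) := by push_cast; ring
  rw [linearOptimum, if_pos (odd_two_mul_add_one m), hcast, div_mul_eq_div_div,
    div_self two_ne_zero]

theorem linearOptimum_even (ε : ℝ) (m : ℕ) :
    linearOptimum ε (2 * m + 2) = Real.log ((m + 2) / (m + 1)) / ε := by
  have hratio : (((2 * m + 2 : ℕ) : ℝ) + 2) / (2 * m + 2 : ℕ) = (m + 2) / (m + 1) := by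
    push_cast
    field_simp
    ring
  rw [linearOptimum, if_neg (Nat.not_odd_iff_even.2 ⟨m + 1, by ring⟩), hratio]

theorem exists_eq_two_mul_add_one_or_two {k : ℕ} (hk : 1 ≤ k) :
    ∃ m, k = 2 * m + 1 ∨ k = 2 * m + 2 :=
  ⟨(k - 1) / 2, by omega⟩

section LinearOptimum

variable {ε : ℝ} (hε : 0 < ε)

include hε

theorem linearOptimum_nonneg (k : ℕ) : 0 ≤ linearOptimum ε k := by
  rw [linearOptimum]
  split_ifs
  · positivity
  · rcases k.eq_zero_or_pos with rfl | hk
    · simp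
    · have : (1 : ℝ) ≤ (k + 2) / k := (one_le_div (by positivity)).2 (by linarith)
      exact div_nonneg (Real.log_nonneg this) hε.le

theorem linearOptimum_le {k : ℕ} (hk : 1 ≤ k) : linearOptimum ε k ≤ 2 / (ε * k) := by
  have : (0 : ℝ) < k := Nat.cast_pos.2 hk
  rw [linearOptimum]
  split_ifs
  · gcongr
    linarith
  · calc Real.log ((k + 2) / k) / ε ≤ ((k + 2) / k - 1) / ε := by
          gcongr; exact Real.log_le_sub_one_of_pos (by positivity)
      _ = 2 / (ε * k) := by field_simp; ring

theorem exp_mul_linearOptimum_even (m : ℕ) : Real.exp (ε * linearOptimum ε (2 * m + 2)) =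
    1 + ε * linearOptimum ε (2 * m + 1) := by
  rw [linearOptimum_even, linearOptimum_odd, mul_div_cancel₀ _ hε.ne',
    Real.exp_log (by positivity)]
  field_simp
  ring

theorem linearOptimum_odd_succ (m : ℕ) : linearOptimum ε (2 * (m + 1) + 1) =
    (1 - Real.exp (-ε * linearOptimum ε (2 * m + 2))) / ε := by
  rw [neg_mul, Real.exp_neg, exp_mul_linearOptimum_even hε, linearOptimum_odd, linearOptimum_odd]
  push_cast
  field_simp
  ring

theorem linearOptimum_odd_le_one_div (m : ℕ) : linearOptimum ε (2 * m + 1) ≤ 1 / ε := by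
  rw [linearOptimum_odd]
  gcongr
  exact le_mul_of_one_le_left hε.le (le_add_of_nonneg_left m.cast_nonneg)

end LinearOptimum

/-! ### Linear disutility: lower bound -/

theorem abs_sub_le_abs_sub_of_midpoint_lt {c b y x : ℝ} (hyc : y ≤ c) (hcb : c ≤ b)
    (hx : (c + b) / 2 < x) : |x - b| ≤ |x - y| := by
  rw [abs_of_nonneg (show 0 ≤ x - y by linarith), abs_le]
  constructor <;> linarith

theorem ofReal_le_infEDist {x r : ℝ} {S : Set ℝ} (h : ∀ y ∈ S, r ≤ |x - y|) :
    ENNReal.ofReal r ≤ Metric.infEDist x S :=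
  Metric.le_infEDist.2 fun y hy => by
    rw [edist_dist, Real.dist_eq]
    exact ENNReal.ofReal_le_ofReal (h y hy)

theorem infEDist_le_ofReal {x y r : ℝ} {S : Set ℝ} (hy : y ∈ S) (h : |x - y| ≤ r) :
    Metric.infEDist x S ≤ ENNReal.ofReal r :=
  Metric.infEDist_le_edist_of_mem hy |>.trans <| by
    rw [edist_dist, Real.dist_eq]
    exact ENNReal.ofReal_le_ofReal h

theorem infEDist_le_infEDist_of_forall_exists {x : ℝ} {S T : Set ℝ}
    (h : ∀ y ∈ S, ∃ z ∈ T, |x - z| ≤ |x - y|) : Metric.infEDist x T ≤ Metric.infEDist x S :=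
  Metric.le_infEDist.2 fun y hy => by
    obtain ⟨z, hz, hzy⟩ := h y hy
    rw [edist_dist, Real.dist_eq]
    exact infEDist_le_ofReal hz hzy

theorem encard_inter_Ioi_add_one_le {α : Type*} [Preorder α] {T : Set α} {b : α} (hb : b ∈ T) :
    (T ∩ Set.Ioi b).encard + 1 ≤ T.encard := by
  rw [← Set.encard_insert_of_notMem fun h => lt_irrefl b h.2]
  exact Set.encard_le_encard (Set.insert_subset hb Set.inter_subset_left)

theorem exists_isLeast_of_encard_le {α : Type*} [LinearOrder α] {T : Set α} (hne : T.Nonempty)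
    {n : ℕ} (hT : T.encard ≤ n) : ∃ b, IsLeast T b :=
  Set.exists_min_image T id (Set.finite_of_encard_le_coe hT) hne

section LowerBound

variable {ε : ℝ} (hε : 0 < ε) {c b : ℝ} {S : Set ℝ} {m : ℕ}

include hε

theorem ofReal_linearOptimum_even_le_expTail_of_lowerBounds (hcb : c ≤ b)
    (hb : b ∈ lowerBounds S)
    (htail : ENNReal.ofReal (linearOptimum ε (2 * m + 1)) ≤
      expTail ε b fun x => Metric.infEDist x S) :
    ENNReal.ofReal (linearOptimum ε (2 * m + 2)) ≤ expTail ε c fun x => Metric.infEDist x S := by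
  rw [← add_sub_cancel c b] at htail
  refine le_trans ?_ <| ofReal_leadCost_le_expTail hε (sub_nonneg.2 hcb)
    (linearOptimum_nonneg hε _) (fun x hx => ofReal_le_infEDist fun y hy => ?_) htail
  · exact ENNReal.ofReal_le_ofReal (le_leadCost_of_exp_eq hε (exp_mul_linearOptimum_even hε m) _)
  · rw [abs_sub_comm]
    exact le_abs.2 (.inl (by linarith [hb hy, hx.2]))

theorem ofReal_linearOptimum_odd_succ_le_expTail_of_isLeast (hb : IsLeast (S ∩ Set.Ioi c) b)
    (htail : ENNReal.ofReal (linearOptimum ε (2 * m + 1)) ≤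
      expTail ε b fun x => Metric.infEDist x (S ∩ Set.Ioi c)) :
    ENNReal.ofReal (linearOptimum ε (2 * (m + 1) + 1)) ≤
      expTail ε c fun x => Metric.infEDist x S := by
  have hcb : c < b := hb.1.2
  have hmid : c + (b - c) / 2 = (c + b) / 2 := by ring
  have hright : ENNReal.ofReal (linearOptimum ε (2 * m + 2)) ≤
      expTail ε (c + (b - c) / 2) fun x => Metric.infEDist x S := by
    refine (ofReal_linearOptimum_even_le_expTail_of_lowerBounds hε (by linarith) hb.2
      htail).trans <| expTail_mono fun x hx => infEDist_le_infEDist_of_forall_exists fun y hy => ?_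
    rcases le_or_gt y c with hyc | hyc
    · exact ⟨b, hb.1, abs_sub_le_abs_sub_of_midpoint_lt hyc hcb.le (hmid ▸ hx)⟩
    · exact ⟨y, ⟨hy, hyc⟩, le_rfl⟩
  refine le_trans ?_ <| ofReal_trailCost_le_expTail hε (by linarith)
    (linearOptimum_nonneg hε _) (fun x hx => ofReal_le_infEDist fun y hy => ?_) hright
  · rw [linearOptimum_odd_succ hε]
    exact ENNReal.ofReal_le_ofReal (le_trailCost hε _ _)
  · rcases le_or_gt y c with hyc | hyc
    · exact le_abs.2 (.inl (by linarith))
    · exact le_abs.2 (.inr (by linarith [hb.2 ⟨hy, hyc⟩, hx.2]))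

theorem ofReal_one_div_le_expTail_infEDist (hS : S ∩ Set.Ioi c = ∅) :
    ENNReal.ofReal (1 / ε) ≤ expTail ε c fun x => Metric.infEDist x S := by
  rw [← expTail_ofReal_sub hε c]
  refine expTail_mono fun x _ => ofReal_le_infEDist fun y hy => le_abs.2 (.inl ?_)
  have hyc : y ≤ c := not_lt.1 fun hcy => hS.subset ⟨hy, hcy⟩
  linarith

theorem ofReal_linearOptimum_odd_le_expTail (hS : (S ∩ Set.Ioi c).encard ≤ m) :
    ENNReal.ofReal (linearOptimum ε (2 * m + 1)) ≤ expTail ε c fun x => Metric.infEDist x S := by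
  induction m generalizing c S with
  | zero =>
    exact (ENNReal.ofReal_le_ofReal (linearOptimum_odd_le_one_div hε 0)).trans
      (ofReal_one_div_le_expTail_infEDist hε (by simpa using hS))
  | succ m ih =>
    rcases (S ∩ Set.Ioi c).eq_empty_or_nonempty with hempty | hne
    · exact (ENNReal.ofReal_le_ofReal (linearOptimum_odd_le_one_div hε _)).trans
        (ofReal_one_div_le_expTail_infEDist hε hempty)
    · obtain ⟨b, hb⟩ := exists_isLeast_of_encard_le hne hS
      refine ofReal_linearOptimum_odd_succ_le_expTail_of_isLeast hε hb (ih ?_)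
      have := (encard_inter_Ioi_add_one_le hb.1).trans hS
      push_cast at this
      exact (ENat.add_le_add_iff_right ENat.one_ne_top).1 this

theorem ofReal_linearOptimum_even_le_expTail (hne : S.Nonempty) (hc : c ∈ lowerBounds S)
    (hS : S.encard ≤ m + 1) :
    ENNReal.ofReal (linearOptimum ε (2 * m + 2)) ≤ expTail ε c fun x => Metric.infEDist x S := by
  obtain ⟨b, hb⟩ := exists_isLeast_of_encard_le (n := m + 1) hne (mod_cast hS)
  refine ofReal_linearOptimum_even_le_expTail_of_lowerBounds hε (hc hb.1) hb.2
    (ofReal_linearOptimum_odd_le_expTail hε ?_)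
  exact (ENat.add_le_add_iff_right ENat.one_ne_top).1 <| (encard_inter_Ioi_add_one_le hb.1).trans hS

end LowerBound

theorem minDisutility_id {k : ℕ} (u : ℝ) (a : Fin k → ℝ) :
    minDisutility (fun z => z) u a = Metric.infEDist u (Set.range a) := by
  simp only [minDisutility, Metric.infEDist, iInf_range, edist_dist, Real.dist_eq]

section SymmetricList

variable {k : ℕ} [NeZero k] {b : Fin k → ℝ}

theorem IsSymmetricList.infEDist_image_le (hb : IsSymmetricList b) {x : ℝ} (hx : 0 < x) :
    Metric.infEDist x (b '' Set.Ici upperMiddle) ≤ Metric.infEDist x (Set.range b) := by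
  refine infEDist_le_infEDist_of_forall_exists ?_
  rintro _ ⟨i, rfl⟩
  rcases le_or_gt upperMiddle i with hi | hi
  · exact ⟨b i, ⟨i, hi, rfl⟩, le_rfl⟩
  · have hrev : upperMiddle ≤ i.rev := Fin.le_rev_iff.2 (le_upperMiddle_rev_of_lt_upperMiddle hi)
    have hnonneg := hb.nonneg i.rev hrev
    refine ⟨b i.rev, ⟨i.rev, hrev, rfl⟩, ?_⟩
    rw [hb.rev] at hnonneg ⊢
    exact abs_sub_le_abs_sub_of_midpoint_lt (c := b i) le_rfl (by linarith) (by linarith)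

theorem encard_image_Ici_upperMiddle_le (b : Fin k → ℝ) :
    (b '' Set.Ici upperMiddle).encard ≤ (k - k / 2 : ℕ) := by
  refine (Set.encard_image_le _ _).trans ?_
  rw [← Finset.coe_Ici, Set.encard_coe_eq_coe_finsetCard, Fin.card_Ici, upperMiddle]

theorem IsSymmetricList.ofReal_linearOptimum_le_laplaceCost (hb : IsSymmetricList b) {ε : ℝ}
    (hε : 0 < ε) : ENNReal.ofReal (linearOptimum ε k) ≤ laplaceCost (fun z => z) ε b := by
  simp only [laplaceCost_eq_expTail_of_rev_eq_neg hb.rev, minDisutility_id]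
  refine le_trans ?_ (expTail_mono fun x hx => hb.infEDist_image_le hx)
  have hcard := encard_image_Ici_upperMiddle_le b
  obtain ⟨m, rfl | rfl⟩ := exists_eq_two_mul_add_one_or_two (NeZero.one_le (n := k))
  · have hzero : b upperMiddle = 0 := by
      have hrev : (upperMiddle : Fin (2 * m + 1)).rev = upperMiddle := by
        ext
        simp only [Fin.val_rev, upperMiddle]
        omega
      have := hb.rev upperMiddle
      rw [hrev] at this
      linarith
    have hmem : 0 ∈ b '' Set.Ici upperMiddle := ⟨_, Set.self_mem_Ici, hzero⟩
    refine ofReal_linearOptimum_odd_le_expTail hε ?_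
    rw [show 2 * m + 1 - (2 * m + 1) / 2 = m + 1 by omega] at hcard
    have := (encard_inter_Ioi_add_one_le hmem).trans hcard
    push_cast at this
    exact (ENat.add_le_add_iff_right ENat.one_ne_top).1 this
  · rw [show 2 * m + 2 - (2 * m + 2) / 2 = m + 1 by omega] at hcard
    refine ofReal_linearOptimum_even_le_expTail hε (Set.nonempty_Ici.image b) ?_
      (mod_cast hcard)
    rintro _ ⟨i, hi, rfl⟩
    exact hb.nonneg i hi

end SymmetricList

/-! ### Linear disutility: the closed-form answers -/

section UpperBound

variable {ε : ℝ} (hε : 0 < ε) {c : ℝ} {S : Set ℝ} {m : ℕ}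

include hε

theorem expTail_le_ofReal_linearOptimum_even_of_mem
    (hmem : c + linearOptimum ε (2 * m + 2) ∈ S)
    (htail : (expTail ε (c + linearOptimum ε (2 * m + 2)) fun x => Metric.infEDist x S) ≤
      ENNReal.ofReal (linearOptimum ε (2 * m + 1))) :
    (expTail ε c fun x => Metric.infEDist x S) ≤
      ENNReal.ofReal (linearOptimum ε (2 * m + 2)) := by
  have := expTail_le_ofReal_leadCost hε (linearOptimum_nonneg hε _) (linearOptimum_nonneg hε _)
    (fun x hx => infEDist_le_ofReal hmem ?_) htail
  · rwa [leadCost_self_of_exp_eq hε (exp_mul_linearOptimum_even hε m)] at this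
  · rw [add_sub_add_left_eq_sub, abs_sub_comm, abs_of_nonneg (sub_nonneg.2 hx.2)]

theorem expTail_le_ofReal_linearOptimum_odd_succ_of_mem (hmem : c ∈ S)
    (htail : (expTail ε (c + linearOptimum ε (2 * m + 2)) fun x => Metric.infEDist x S) ≤
      ENNReal.ofReal (linearOptimum ε (2 * m + 2))) :
    (expTail ε c fun x => Metric.infEDist x S) ≤
      ENNReal.ofReal (linearOptimum ε (2 * (m + 1) + 1)) := by
  have := expTail_le_ofReal_trailCost hε (linearOptimum_nonneg hε _) (linearOptimum_nonneg hε _)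
    (fun x hx => infEDist_le_ofReal hmem ?_) htail
  · rwa [trailCost_self hε, ← linearOptimum_odd_succ hε] at this
  · rw [add_sub_cancel_left, abs_of_pos hx.1]

end UpperBound

theorem closedFormRadius_odd (m : ℕ) (ε : ℝ) (j : ℕ) :
    closedFormRadius (2 * m + 1) ε j = 2 * Real.log ((m + 1) / j) / ε := by
  have hcast : (((2 * m + 1 : ℕ) : ℝ) + 1) / 2 = m + 1 := by push_cast; ring
  rw [closedFormRadius, if_pos (odd_two_mul_add_one m), hcast]

theorem closedFormRadius_even (m : ℕ) (ε : ℝ) (j : ℕ) :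
    closedFormRadius (2 * m + 2) ε j = Real.log ((m + 1) * (m + 2) / (j : ℝ) ^ 2) / ε := by
  have hcast : ((2 * m + 2 : ℕ) : ℝ) / 2 = m + 1 := by push_cast; ring
  rw [closedFormRadius, if_neg (Nat.not_odd_iff_even.2 ⟨m + 1, by ring⟩), hcast, add_assoc,
    one_add_one_eq_two]

theorem closedFormRadius_odd_self (m : ℕ) (ε : ℝ) :
    closedFormRadius (2 * m + 1) ε (m + 1) = 0 := by
  rw [closedFormRadius_odd, Nat.cast_add_one, div_self (by positivity), Real.log_one, mul_zero,
    zero_div]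

theorem closedFormRadius_even_eq_add (m : ℕ) (ε : ℝ) {j : ℕ} (hj : 1 ≤ j) :
    closedFormRadius (2 * m + 2) ε j =
      linearOptimum ε (2 * m + 2) + closedFormRadius (2 * m + 1) ε j := by
  have : (0 : ℝ) < j := Nat.cast_pos.2 hj
  have hlog : Real.log ((m + 1) * (m + 2) / (j : ℝ) ^ 2) =
      Real.log ((m + 2) / (m + 1)) + 2 * Real.log ((m + 1) / j) := by
    rw [← Nat.cast_two, ← Real.log_pow, ← Real.log_mul (by positivity) (by positivity)]
    field_simp
  rw [closedFormRadius_even, closedFormRadius_odd, linearOptimum_even, hlog, add_div]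

theorem closedFormRadius_odd_succ_eq_add (m : ℕ) (ε : ℝ) {j : ℕ} (hj : 1 ≤ j) :
    closedFormRadius (2 * (m + 1) + 1) ε j =
      linearOptimum ε (2 * m + 2) + closedFormRadius (2 * m + 2) ε j := by
  have : (0 : ℝ) < j := Nat.cast_pos.2 hj
  have hlog : 2 * Real.log ((m + 2) / j) =
      Real.log ((m + 2) / (m + 1)) + Real.log ((m + 1) * (m + 2) / (j : ℝ) ^ 2) := by
    rw [← Nat.cast_two, ← Real.log_pow, ← Real.log_mul (by positivity) (by positivity)]
    field_simp
  rw [closedFormRadius_even, closedFormRadius_odd, linearOptimum_even, ← add_div, ← hlog,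
    Nat.cast_add_one, add_assoc, one_add_one_eq_two]

section UpperBound

variable {ε : ℝ} (hε : 0 < ε) {m : ℕ}

include hε

theorem expTail_infEDist_le_ofReal_linearOptimum_odd {c : ℝ} {S : Set ℝ}
    (hS : ∀ j ∈ Set.Icc 1 (m + 1), c + closedFormRadius (2 * m + 1) ε j ∈ S) :
    (expTail ε c fun x => Metric.infEDist x S) ≤
      ENNReal.ofReal (linearOptimum ε (2 * m + 1)) := by
  induction m generalizing c with
  | zero =>
    have hmem := hS 1 ⟨le_rfl, le_rfl⟩
    rw [closedFormRadius_odd_self, add_zero] at hmem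
    rw [linearOptimum_odd, Nat.cast_zero, zero_add, one_mul, ← expTail_ofReal_sub hε c]
    exact expTail_mono fun x hx =>
      infEDist_le_ofReal hmem (abs_of_pos (sub_pos.2 hx)).le
  | succ m ih =>
    have hmem := hS (m + 1 + 1) ⟨by omega, le_rfl⟩
    rw [closedFormRadius_odd_self, add_zero] at hmem
    have hS' (j : ℕ) (hj : j ∈ Set.Icc 1 (m + 1)) : c + linearOptimum ε (2 * m + 2) +
        linearOptimum ε (2 * m + 2) + closedFormRadius (2 * m + 1) ε j ∈ S := by
      rw [add_assoc, ← closedFormRadius_even_eq_add m ε hj.1, add_assoc,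
        ← closedFormRadius_odd_succ_eq_add m ε hj.1]
      exact hS j ⟨hj.1, hj.2.trans (Nat.le_succ _)⟩
    have hnext := hS' (m + 1) ⟨by omega, le_rfl⟩
    rw [closedFormRadius_odd_self, add_zero] at hnext
    exact expTail_le_ofReal_linearOptimum_odd_succ_of_mem hε hmem
      (expTail_le_ofReal_linearOptimum_even_of_mem hε hnext (ih hS'))

theorem expTail_infEDist_le_ofReal_linearOptimum_even {c : ℝ} {S : Set ℝ}
    (hS : ∀ j ∈ Set.Icc 1 (m + 1), c + closedFormRadius (2 * m + 2) ε j ∈ S) :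
    (expTail ε c fun x => Metric.infEDist x S) ≤
      ENNReal.ofReal (linearOptimum ε (2 * m + 2)) := by
  have hS' (j : ℕ) (hj : j ∈ Set.Icc 1 (m + 1)) :
      c + linearOptimum ε (2 * m + 2) + closedFormRadius (2 * m + 1) ε j ∈ S := by
    rw [add_assoc, ← closedFormRadius_even_eq_add m ε hj.1]
    exact hS j hj
  have hnext := hS' (m + 1) ⟨by omega, le_rfl⟩
  rw [closedFormRadius_odd_self, add_zero] at hnext
  exact expTail_le_ofReal_linearOptimum_even_of_mem hε hnext
    (expTail_infEDist_le_ofReal_linearOptimum_odd hε hS')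

end UpperBound

theorem closedFormPoint_rev (k : ℕ) (ε : ℝ) (i : Fin k) :
    closedFormPoint k ε i.rev = -closedFormPoint k ε i := by
  rw [closedFormPoint, closedFormPoint, Fin.val_rev]
  rcases lt_trichotomy (2 * ((i : ℕ) + 1)) (k + 1) with hlt | heq | hgt
  · rw [if_neg (by omega), if_pos hlt.le, neg_neg, show k - (k - (i + 1)) = (i : ℕ) + 1 by omega]
  · have hzero (j : ℕ) (hj : k = 2 * j + 1) : closedFormRadius k ε (j + 1) = 0 :=
      hj ▸ closedFormRadius_odd_self j ε
    rw [if_pos (by omega), if_pos heq.le, show k - (i + 1) + 1 = (i : ℕ) + 1 by omega,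
      hzero i (by omega), neg_zero, neg_zero]
  · rw [if_pos (by omega), if_neg hgt.not_ge, show k - (i + 1) + 1 = k - (i : ℕ) by omega]

theorem closedFormRadius_mem_range_closedFormPoint {k : ℕ} (ε : ℝ) {j : ℕ} (hj : 1 ≤ j)
    (hjk : 2 * j ≤ k + 1) : closedFormRadius k ε j ∈ Set.range (closedFormPoint k ε) := by
  refine ⟨(⟨j - 1, by omega⟩ : Fin k).rev, ?_⟩
  rw [closedFormPoint_rev, closedFormPoint, if_pos (by simp only; omega), neg_neg,
    Nat.sub_add_cancel hj]

theorem laplaceCost_closedFormPoint_le {k : ℕ} (hk : 1 ≤ k) {ε : ℝ} (hε : 0 < ε) :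
    laplaceCost (fun z => z) ε (closedFormPoint k ε) ≤ ENNReal.ofReal (linearOptimum ε k) := by
  simp only [laplaceCost_eq_expTail_of_rev_eq_neg (closedFormPoint_rev k ε), minDisutility_id]
  have hmem {j : ℕ} (hj : 1 ≤ j) (hjk : 2 * j ≤ k + 1) :
      0 + closedFormRadius k ε j ∈ Set.range (closedFormPoint k ε) := by
    rw [zero_add]
    exact closedFormRadius_mem_range_closedFormPoint ε hj hjk
  obtain ⟨m, rfl | rfl⟩ := exists_eq_two_mul_add_one_or_two hk
  · exact expTail_infEDist_le_ofReal_linearOptimum_odd hε fun j hj =>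
      hmem hj.1 (by have := hj.2; omega)
  · exact expTail_infEDist_le_ofReal_linearOptimum_even hε fun j hj =>
      hmem hj.1 (by have := hj.2; omega)

section LinearCost

variable {g : ℝ≥0 → ℝ≥0∞} {ε : ℝ} (hg : HasSupportingTangent g ε) (k : ℕ) [NeZero k]

include hg

theorem optimalCost_id_eq :
    optimalCost.{v} (fun z => z) g k = ENNReal.ofReal (linearOptimum ε k) := by
  have hc : ContinuousOn (fun z : ℝ => z) (Set.Ici 0) := continuousOn_id
  have hm : MonotoneOn (fun z : ℝ => z) (Set.Ici 0) := monotoneOn_id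
  refine le_antisymm ?_ ?_
  · exact (optimalCost_le_laplaceCost hm hg _).trans
      (laplaceCost_closedFormPoint_le NeZero.one_le hg.pos)
  · obtain ⟨a, ha⟩ :=
      exists_laplaceCost_eq_optimalCost.{v} (k := k) hc.lowerSemicontinuousOn hm hg
    rw [← ha]
    exact le_laplaceCost_of_forall_isSymmetricList hm hg.pos
      (fun b hb => hb.ofReal_linearOptimum_le_laplaceCost hg.pos) a

theorem mechanismCost_closedFormPoint_eq_optimalCost :
    mechanismCost (fun z => z) (laplaceAction ε) (shiftResponse (closedFormPoint k ε)) =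
      optimalCost.{v} (fun z => z) g k := by
  have hm : MonotoneOn (fun z : ℝ => z) (Set.Ici 0) := monotoneOn_id
  rw [mechanismCost_laplaceAction_shiftResponse hm]
  refine le_antisymm ?_ (optimalCost_le_laplaceCost hm hg _)
  rw [optimalCost_id_eq hg]
  exact laplaceCost_closedFormPoint_le NeZero.one_le hg.pos

end LinearCost

theorem theorem5_general :
    (∀ (h : ℝ → ℝ), LowerSemicontinuousOn h (Set.Ici 0) → MonotoneOn h (Set.Ici 0) → 0 ≤ h 0 →
      ∀ (g : ℝ≥0 → ℝ≥0∞) (ε : ℝ), HasSupportingTangent g ε → ∀ k : ℕ, 1 ≤ k →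
        IsGeoPrivate g (laplaceAction ε) ∧
        ∃ Q : Kernel ℝ (Fin k → ℝ), IsMarkovKernel Q ∧
          mechanismCost h (laplaceAction ε) Q = optimalCost.{v} h g k) ∧
    (∃ C : ℝ, 0 < C ∧
      ∀ (g : ℝ≥0 → ℝ≥0∞) (ε : ℝ), HasSupportingTangent g ε → ∀ k : ℕ, 1 ≤ k →
        optimalCost.{v} (fun z => z) g k ≤ ENNReal.ofReal (C / (ε * k))) ∧
    (∀ (g : ℝ≥0 → ℝ≥0∞) (ε : ℝ), HasSupportingTangent g ε → ∀ k : ℕ, 1 ≤ k →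
      mechanismCost (fun z => z) (laplaceAction ε) (shiftResponse (closedFormPoint k ε)) =
        optimalCost.{v} (fun z => z) g k) := by
  refine ⟨fun h hc hm _ g ε hg k hk => ⟨isGeoPrivate_laplaceAction hg, ?_⟩,
    ⟨2, two_pos, fun g ε hg k hk => ?_⟩, fun g ε hg k hk => ?_⟩ <;>
  have : NeZero k := ⟨by omega⟩
  · obtain ⟨a, ha⟩ := exists_laplaceCost_eq_optimalCost.{v} (k := k) hc hm hg
    exact ⟨shiftResponse a, isMarkovKernel_shiftResponse a,
      (mechanismCost_laplaceAction_shiftResponse hm ε a).trans ha⟩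
  · rw [optimalCost_id_eq hg]
    exact ENNReal.ofReal_le_ofReal (linearOptimum_le hg.pos hk)
  · exact mechanismCost_closedFormPoint_eq_optimalCost hg k

theorem theorem5 :
    -- Laplace noise of rate `g'(0)` is an optimal user action
    (∀ (h : ℝ → ℝ), IsDisutility h →
      ∀ (g : ℝ≥0 → ℝ≥0∞) (ε : ℝ), IsPrivacyProfile g ε → ∀ k : ℕ, 1 ≤ k →
        IsGeoPrivate g (laplaceAction ε) ∧
        ∃ Q : Kernel ℝ (Fin k → ℝ), IsMarkovKernel Q ∧
          mechanismCost h (laplaceAction ε) Q = optimalCost.{v} h g k) ∧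
    -- for `h z = z` the optimal cost is `O(1 / (g'(0) k))`, with an absolute constant
    (∃ C : ℝ, 0 < C ∧
      ∀ (g : ℝ≥0 → ℝ≥0∞) (ε : ℝ), IsPrivacyProfile g ε → ∀ k : ℕ, 1 ≤ k →
        optimalCost.{v} (fun z => z) g k ≤ ENNReal.ofReal (C / (ε * k))) ∧
    -- for `h z = z` an optimal mechanism in closed form
    (∀ (g : ℝ≥0 → ℝ≥0∞) (ε : ℝ), IsPrivacyProfile g ε → ∀ k : ℕ, 1 ≤ k →
      mechanismCost (fun z => z) (laplaceAction ε) (shiftResponse (closedFormPoint k ε)) =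
        optimalCost.{v} (fun z => z) g k) :=
  ⟨fun h hh g ε hg => theorem5_general.1 h hh.continuousOn.lowerSemicontinuousOn hh.monotoneOn
      hh.map_zero.ge g ε hg.hasSupportingTangent,
    theorem5_general.2.1.imp fun _ hC => ⟨hC.1, fun g ε hg => hC.2 g ε hg.hasSupportingTangent⟩,
    fun g ε hg => theorem5_general.2.2 g ε hg.hasSupportingTangent⟩
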